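/- Let $d\ge 1$, let $r=(r_1,\dots,r_d)\in\mathbb N^d$, and let $\sigma=(\sigma_1,\dots,\sigma_d)$ with $0<\sigma_l<r_l+1$ for every $l$. Put $\underline\sigma=\min_l\sigma_l$, $H(\sigma)=\bigl(\frac1d\sum_{l=1}^d\frac1{\sigma_l}\bigr)^{-1}$ and $(x)_+=\max\{x,0\}$. Functions on $[0,1]^d$ are real-valued and measurable; $\|\cdot\|_p$ denotes the $\mathbb L_p$-(quasi-)norm for Lebesgue measure on $[0,1]^d$, which for $p=\infty$ is the essential supremum. A dyadic rectangle of $[0,1]^d$ is a product $I_1\times\cdots\times I_d$ where each $I_l$ is either $[0,2^{-j_l}]$ or $(k_l2^{-j_l},(k_l+1)2^{-j_l}]$, with $j_l\in\mathbb N$ and $k_l\in\{1,\dots,2^{j_l}-1\}$. For $k\in\mathbb N$ let $\mathcal D_k^{\sigma}$ be the set of all dyadic rectangles with sidelength $2^{-\lfloor k\underline\sigma/\sigma_l\rfloor}$ in the $l$-th direction for $l=1,\dots,d$. Let $\Pi_k$ be the set of functions on $[0,1]^d$ that coincide, on each rectangle of $\mathcal D_k^\sigma$, with a polynomial of degree $\le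 r_l$ in the $l$-th variable for every $l$. For $0<p<\infty$, $0<p'\le\infty$ and $s\in\mathbb L_p([0,1]^d)$ let $e_k(s)=\inf_{P\in\Pi_k}\|s-P\|_p$, let $$N_{p,p'}(s)=\Bigl(\sum_{k\in\mathbb N}\bigl(2^{k\underline\sigma}e_k(s)\bigr)^{p'}\Bigr)^{1/p'}\ \text{ if }p'<\infty,\qquad N_{p,\infty}(s)=\sup_{k\in\mathbb N}2^{k\underline\sigma}e_k(s),$$ and, for $R>0$, let $\mathcal S(r,\sigma,p,p',R)=\{s\in\mathbb L_p([0,1]^d):N_{p,p'}(s)\le R\}$. For $J\in\mathbb N$ and $D\in\mathbb N$ with $D\ge1$, let $\mathcal M_D^J$ be the set of all partitions of $[0,1]^d$ into exactly $D$ dyadic rectangles with all sidelengths $\ge 2^{-J}$. For $m\in\mathcal M_D^J$ let $S_{(m,r)}$ be the space of functions that coincide, on each rectangle of $m$, with a polynomial of degree $\le r_l$ in the $l$-th variable for every $l$. Let $0<p<\infty$ and $1\le q\le\infty$ satisfy $H(\sigma)/d>(1/p-1/q)_+$ (with $1/\infty=0$). Then there is a constant $C>0$, depending only on $d,r,\sigma,p,q$,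 such that the following holds for all $J\in\mathbb N$, all $R>0$, all $0<p'\le\infty$ subject to $p'\le p$ in the case $1<p<q$ (and arbitrary if $p\le1$ or $p\ge q$), and all integers $D$ with $1\le D\le 2^{Jd}$: $$\sup_{s\in\mathcal S(r,\sigma,p,p',R)}\ \inf_{t\in\bigcup_{m\in\mathcal M_D^J}S_{(m,r)}}\|s-t\|_q\ \le\ C\,R\left(2^{-Jd\left(H(\sigma)/d-(1/p-1/q)_+\right)\underline\sigma/H(\sigma)}+D^{-H(\sigma)/d}\right).$$ -/

import Mathlib

open MeasureTheory
open scoped ENNReal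

noncomputable section

namespace AnisoDyadic

/-- The unit cube `[0,1]^d`. -/
def unitCube (d : ℕ) : Set (Fin d → ℝ) := Set.Icc 0 1

/-- Lebesgue measure on the unit cube. -/
def cubeMeasure (d : ℕ) : Measure (Fin d → ℝ) := volume.restrict (unitCube d)

/-- The dyadic interval of length `2^{-j}` with index `k`: it is `[0, 2^{-j}]` when `k = 0` and
`(k 2^{-j}, (k+1) 2^{-j}]` otherwise. -/
def dyadicInterval (j k : ℕ) : Set ℝ :=
  if k = 0 then Set.Icc 0 ((2 : ℝ) ^ j)⁻¹
  else Set.Ioc ((k : ℝ) * ((2 : ℝ) ^ j)⁻¹) (((k : ℝ) + 1) * ((2 : ℝ) ^ j)⁻¹)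

/-- The product over the directions `l` of the dyadic intervals of lengths `2^{-j l}` with
indices `k l`. -/
def dyadicBox {d : ℕ} (j k : Fin d → ℕ) : Set (Fin d → ℝ) :=
  {x | ∀ l, x l ∈ dyadicInterval (j l) (k l)}

/-- The collection of all dyadic rectangles of `[0,1]^d` with sidelength exactly `2^{-j l}`
in each direction `l`. -/
def dyadicBoxes {d : ℕ} (j : Fin d → ℕ) : Set (Set (Fin d → ℝ)) :=
  {K | ∃ k : Fin d → ℕ, (∀ l, k l < 2 ^ j l) ∧ K = dyadicBox j k}

/-- The smallest coordinate of `σ`. -/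
def minSmooth {d : ℕ} (σ : Fin d → ℝ) : ℝ := ⨅ l, σ l

/-- The harmonic mean of the coordinates of `σ`. -/
def harmMean {d : ℕ} (σ : Fin d → ℝ) : ℝ := ((1 / (d : ℝ)) * ∑ l, 1 / σ l)⁻¹

/-- The collection of dyadic rectangles of `[0,1]^d` with sidelength `2^{-⌊j min σ / σ_l⌋}` in
each direction `l`. -/
def anisoBoxes {d : ℕ} (σ : Fin d → ℝ) (j : ℕ) : Set (Set (Fin d → ℝ)) :=
  dyadicBoxes fun l => ⌊(j : ℝ) * minSmooth σ / σ l⌋₊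

/-- Functions that coincide, on each set of the collection `𝒦`, with a polynomial of degree at
most `r l` in each variable `l` (the polynomial may depend on the set). -/
def piecewisePoly {d : ℕ} (r : Fin d → ℕ) (𝒦 : Set (Set (Fin d → ℝ))) :
    Set ((Fin d → ℝ) → ℝ) :=
  {t | ∀ K ∈ 𝒦, ∃ P : MvPolynomial (Fin d) ℝ,
    (∀ l, P.degreeOf l ≤ r l) ∧ ∀ x ∈ K, t x = MvPolynomial.eval x P}

/-- The (quasi-)norm of a function in `L_q([0,1]^d)`, `0 < q ≤ ∞`. -/
def cubeNorm {d : ℕ} (q : ℝ≥0∞) (f : (Fin d → ℝ) → ℝ) : ℝ≥0∞ := eLpNorm f q (cubeMeasure d)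

/-- The `L_p`-distance from `s` to the piecewise polynomial functions on the anisotropic dyadic
grid of level `k`. -/
def approxError {d : ℕ} (r : Fin d → ℕ) (σ : Fin d → ℝ) (p : ℝ) (k : ℕ)
    (s : (Fin d → ℝ) → ℝ) : ℝ≥0∞ :=
  ⨅ t ∈ piecewisePoly r (anisoBoxes σ k), cubeNorm (ENNReal.ofReal p) (s - t)

/-- The smoothness (quasi-)semi-norm: the `ℓ_{p'}`-(quasi-)norm of the sequence of weighted
errors `2^{k min σ} e_k(s)`, `k ∈ ℕ`. -/
def smoothSeminorm {d : ℕ} (r : Fin d → ℕ) (σ : Fin d → ℝ) (p : ℝ) (p' : ℝ≥0∞)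
    (s : (Fin d → ℝ) → ℝ) : ℝ≥0∞ :=
  if p' = ∞ then
    ⨆ k : ℕ, ENNReal.ofReal ((2 : ℝ) ^ ((k : ℝ) * minSmooth σ)) * approxError r σ p k s
  else
    (∑' k : ℕ, (ENNReal.ofReal ((2 : ℝ) ^ ((k : ℝ) * minSmooth σ)) * approxError r σ p k s)
      ^ p'.toReal) ^ (1 / p'.toReal)

/-- The class of functions in `L_p([0,1]^d)` whose smoothness semi-norm is at most `R`. -/
def smoothClass {d : ℕ} (r : Fin d → ℕ) (σ : Fin d → ℝ) (p : ℝ) (p' : ℝ≥0∞) (R : ℝ) :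
    Set ((Fin d → ℝ) → ℝ) :=
  {s | MemLp s (ENNReal.ofReal p) (cubeMeasure d) ∧
    smoothSeminorm r σ p p' s ≤ ENNReal.ofReal R}

/-- The set of all partitions of `[0,1]^d` into exactly `D` dyadic rectangles, all of whose
sidelengths `2^{-j l}` are at least `2^{-J}`. -/
def dyadicPartitions (d J D : ℕ) : Set (Finset (Set (Fin d → ℝ))) :=
  {m | m.card = D ∧
    (∀ K ∈ m, ∃ j : Fin d → ℕ, (∀ l, j l ≤ J) ∧ K ∈ dyadicBoxes j) ∧
    (m : Set (Set (Fin d → ℝ))).PairwiseDisjoint id ∧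
    ⋃ K ∈ m, K = unitCube d}

/-- The nonlinear approximation space: all functions that are piecewise polynomial, of degree
at most `r l` in each variable `l`, over some partition in `dyadicPartitions d J D`. -/
def nonlinSpace {d : ℕ} (r : Fin d → ℕ) (J D : ℕ) : Set ((Fin d → ℝ) → ℝ) :=
  ⋃ m ∈ dyadicPartitions d J D, piecewisePoly r (m : Set (Set (Fin d → ℝ)))

/-- The positive part `(1/p - 1/q)_+`, with `1/∞ = 0`. -/
def expGap (p : ℝ) (q : ℝ≥0∞) : ℝ := max (1 / p - (q⁻¹).toReal) 0

end AnisoDyadic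

end

/-! Write `S` for the smallest smoothness, `β = S ∑ 1/σ_l` for the growth rate of the logarithm of
the grid size, and `γ = (1/p - 1/q)_+`. Then `H(σ)/d = S/β`, and the hypothesis on `H(σ)` says that
`δ = S - βγ` is positive. The smoothness class enters only through the bound `e_n(s) ≤ R 2^{-nS}`
for every `n`.

If `q ≤ p`, the uniform grid of a well chosen level suffices. If `p < q`, take near-best
approximations `t_n` on the grids and their increments `u_n = t_n - t_{n-1}`, of `L_p` size `O(R
2^{-nS})`. A polynomial of bounded degree is controlled on a box by its `L_p` mean there
(`exists_dyadicBox_sup_bound`), so `u_n` can be large on few boxes only. With these boxes marked,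
`u_n` is small in `L_q` off them (`exists_marking`). For `k < n ≤ J` at most `2^{kβ} 2^{-ε(n-k)}`
boxes are marked. The approximant is `t_k` plus the increments `u_n` restricted to their marked
boxes.

The error has two parts. The unmarked pieces sum geometrically to `O(R 2^{-kS})`, and the levels
beyond `J` contribute `O(R 2^{-Jδ})`. The approximant is piecewise polynomial on the leaves of a
tree of boxes. A marked box of level `n` is charged at most `2^d (n - k)` leaves
(`exists_leaf_partition`), so there are `O(2^{kβ})` leaves in all. Choosing `k` with `2^{kβ}`
comparable to `D`, when `k ≤ J` allows it, turns `2^{-kS}` into `D^{-S/β}`. Splitting boxes then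
brings the number of pieces to exactly `D`. -/

namespace AnisoDyadic

variable {d : ℕ}

/-! ### Dyadic intervals and boxes: partition and nesting -/

lemma nonneg_of_mem_dyadicInterval {j k : ℕ} {x : ℝ} (hx : x ∈ dyadicInterval j k) : 0 ≤ x := by
  unfold dyadicInterval at hx
  split_ifs at hx with h
  · exact hx.1
  · exact le_trans (by positivity) hx.1.le

/-- A point determines its index, which gives disjointness at a fixed level. Truncated subtraction
sends `x = 0` to index `0`, in accordance with the closed left end of the first interval. -/
lemma index_eq_of_mem_dyadicInterval {j k : ℕ} {x : ℝ} (hx : x ∈ dyadicInterval j k) :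
    ⌈x * 2 ^ j⌉₊ - 1 = k := by
  have h2 : (0 : ℝ) < 2 ^ j := by positivity
  unfold dyadicInterval at hx
  split_ifs at hx with h
  · have h1 : x * 2 ^ j ≤ (1 : ℕ) := by
      have := mul_le_mul_of_nonneg_right hx.2 h2.le
      rw [inv_mul_cancel₀ h2.ne'] at this
      simpa using this
    have := Nat.ceil_le.2 h1
    omega
  · have h1 : (k : ℝ) < x * 2 ^ j := by
      have := mul_lt_mul_of_pos_right hx.1 h2
      rwa [mul_assoc, inv_mul_cancel₀ h2.ne', mul_one] at this
    have h3 : x * 2 ^ j ≤ (k + 1 : ℕ) := by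
      have := mul_le_mul_of_nonneg_right hx.2 h2.le
      rw [mul_assoc, inv_mul_cancel₀ h2.ne', mul_one] at this
      exact_mod_cast this
    have h4 := Nat.ceil_le.2 h3
    have h5 := Nat.lt_ceil.2 h1
    omega

lemma mem_dyadicInterval_index (j : ℕ) {x : ℝ} (hx : 0 ≤ x) :
    x ∈ dyadicInterval j (⌈x * 2 ^ j⌉₊ - 1) := by
  have h2 : (0 : ℝ) < 2 ^ j := by positivity
  have h3 : x = x * 2 ^ j * ((2 : ℝ) ^ j)⁻¹ := by
    rw [mul_assoc, mul_inv_cancel₀ h2.ne', mul_one]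
  unfold dyadicInterval
  split_ifs with h
  · refine ⟨hx, ?_⟩
    have h4 : x * 2 ^ j ≤ 1 := by
      have : x * 2 ^ j ≤ (1 : ℕ) := Nat.ceil_le.1 (by omega)
      simpa using this
    rw [h3]
    exact (mul_le_mul_of_nonneg_right h4 (by positivity)).trans_eq (one_mul _)
  · obtain ⟨n, hn⟩ : ∃ n, ⌈x * 2 ^ j⌉₊ = n + 1 := ⟨⌈x * 2 ^ j⌉₊ - 1, by omega⟩
    rw [hn]
    have h4 : (n : ℝ) < x * 2 ^ j := Nat.lt_ceil.1 (by omega)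
    have h5 : x * 2 ^ j ≤ (n + 1 : ℕ) := Nat.ceil_le.1 hn.le
    push_cast at h5
    rw [Nat.add_sub_cancel]
    constructor
    · conv_rhs => rw [h3]
      exact mul_lt_mul_of_pos_right h4 (by positivity)
    · conv_lhs => rw [h3]
      exact mul_le_mul_of_nonneg_right h5 (by positivity)

lemma dyadicInterval_subset_Icc (j k : ℕ) :
    dyadicInterval j k ⊆ Set.Icc (k * ((2 : ℝ) ^ j)⁻¹) ((k + 1) * ((2 : ℝ) ^ j)⁻¹) := by
  unfold dyadicInterval
  split_ifs with h
  · simp [h]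
  · exact Set.Ioc_subset_Icc_self

lemma Ioc_subset_dyadicInterval (j k : ℕ) :
    Set.Ioc (k * ((2 : ℝ) ^ j)⁻¹) ((k + 1) * ((2 : ℝ) ^ j)⁻¹) ⊆ dyadicInterval j k := by
  unfold dyadicInterval
  split_ifs with h
  · simpa [h] using Set.Ioc_subset_Icc_self
  · exact subset_rfl

lemma dyadicInterval_subset_parent {j j' : ℕ} (hj : j ≤ j') (k : ℕ) :
    dyadicInterval j' k ⊆ dyadicInterval j (k / 2 ^ (j' - j)) := by
  obtain ⟨i, rfl⟩ := Nat.exists_eq_add_of_le hj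
  rw [Nat.add_sub_cancel_left]
  intro x hx
  have h2 : (0 : ℝ) < 2 ^ j := by positivity
  have h2i : (0 : ℝ) < 2 ^ i := by positivity
  have hx' := dyadicInterval_subset_Icc _ _ hx
  have hinv : ((2 : ℝ) ^ j)⁻¹ = 2 ^ i * ((2 : ℝ) ^ (j + i))⁻¹ := by
    rw [pow_add]; field_simp
  have h0 : (0 : ℝ) ≤ ((2 : ℝ) ^ (j + i))⁻¹ := by positivity
  have hup : x ≤ ((k / 2 ^ i : ℕ) + 1) * ((2 : ℝ) ^ j)⁻¹ := by
    rw [hinv, ← mul_assoc]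
    refine hx'.2.trans (mul_le_mul_of_nonneg_right ?_ h0)
    have : k + 1 ≤ (k / 2 ^ i + 1) * 2 ^ i := by
      have := Nat.lt_div_mul_add (a := k) (b := 2 ^ i) (by positivity)
      rw [add_mul, one_mul]; omega
    exact_mod_cast this
  have hlow : ((k / 2 ^ i : ℕ) : ℝ) * ((2 : ℝ) ^ j)⁻¹ ≤ k * ((2 : ℝ) ^ (j + i))⁻¹ := by
    rw [hinv, ← mul_assoc]
    refine mul_le_mul_of_nonneg_right ?_ h0
    exact_mod_cast Nat.div_mul_le_self k (2 ^ i)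
  -- Only intervals of index `0` contain their left endpoint. A nonzero parent index forces a
  -- nonzero child index, so the child is half open and its strict lower bound passes to the parent.
  by_cases hm : k / 2 ^ i = 0
  · rw [hm] at hup ⊢
    refine ⟨nonneg_of_mem_dyadicInterval hx, ?_⟩
    simpa using hup
  · refine Ioc_subset_dyadicInterval _ _ ⟨hlow.trans_lt ?_, hup⟩
    have hk : k ≠ 0 := by rintro rfl; simp at hm
    rw [dyadicInterval, if_neg hk] at hx
    exact hx.1

lemma measurableSet_dyadicInterval (j k : ℕ) : MeasurableSet (dyadicInterval j k) := by
  unfold dyadicInterval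
  split_ifs
  · exact measurableSet_Icc
  · exact measurableSet_Ioc

lemma volume_dyadicInterval (j k : ℕ) : volume (dyadicInterval j k) = (2 : ℝ≥0∞)⁻¹ ^ j := by
  have : ENNReal.ofReal ((2 : ℝ) ^ j)⁻¹ = (2 : ℝ≥0∞)⁻¹ ^ j := by
    rw [ENNReal.ofReal_inv_of_pos (by positivity), ENNReal.ofReal_pow (by norm_num),
      ENNReal.inv_pow]
    simp
  unfold dyadicInterval
  split_ifs
  · rw [Real.volume_Icc, sub_zero, this]
  · rw [Real.volume_Ioc, ← this]
    congr 1
    ring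

lemma dyadicBox_eq_pi (j k : Fin d → ℕ) :
    dyadicBox j k = Set.univ.pi fun l => dyadicInterval (j l) (k l) := by
  ext x; simp [dyadicBox]

lemma measurableSet_dyadicBox (j k : Fin d → ℕ) : MeasurableSet (dyadicBox j k) := by
  rw [dyadicBox_eq_pi]
  exact MeasurableSet.univ_pi fun l => measurableSet_dyadicInterval _ _

lemma volume_dyadicBox (j k : Fin d → ℕ) :
    volume (dyadicBox j k) = (2 : ℝ≥0∞)⁻¹ ^ ∑ l, j l := by
  rw [dyadicBox_eq_pi, volume_pi_pi, ← Finset.prod_pow_eq_pow_sum]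
  exact Finset.prod_congr rfl fun l _ => volume_dyadicInterval _ _

lemma measurableSet_of_mem_dyadicBoxes {j : Fin d → ℕ} {K : Set (Fin d → ℝ)}
    (hK : K ∈ dyadicBoxes j) : MeasurableSet K := by
  obtain ⟨k, -, rfl⟩ := hK
  exact measurableSet_dyadicBox j k

lemma volume_of_mem_dyadicBoxes {j : Fin d → ℕ} {K : Set (Fin d → ℝ)} (hK : K ∈ dyadicBoxes j) :
    volume K = (2 : ℝ≥0∞)⁻¹ ^ ∑ l, j l := by
  obtain ⟨k, -, rfl⟩ := hK
  exact volume_dyadicBox j k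

lemma nonempty_of_mem_dyadicBoxes {j : Fin d → ℕ} {K : Set (Fin d → ℝ)}
    (hK : K ∈ dyadicBoxes j) : K.Nonempty := by
  rw [Set.nonempty_iff_ne_empty]
  rintro rfl
  have := volume_of_mem_dyadicBoxes hK
  rw [measure_empty] at this
  exact (pow_ne_zero _ (by simp)) this.symm

lemma eq_of_mem_dyadicBoxes {j : Fin d → ℕ} {K K' : Set (Fin d → ℝ)} (hK : K ∈ dyadicBoxes j)
    (hK' : K' ∈ dyadicBoxes j) {x : Fin d → ℝ} (hx : x ∈ K) (hx' : x ∈ K') : K = K' := by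
  obtain ⟨k, -, rfl⟩ := hK
  obtain ⟨k', -, rfl⟩ := hK'
  congr 1
  ext l
  rw [← index_eq_of_mem_dyadicInterval (hx l), ← index_eq_of_mem_dyadicInterval (hx' l)]

lemma pairwiseDisjoint_dyadicBoxes (j : Fin d → ℕ) :
    (dyadicBoxes j).PairwiseDisjoint id := by
  intro K hK K' hK' hne
  rw [Function.onFun, id, id, Set.disjoint_left]
  exact fun x hx hx' => hne (eq_of_mem_dyadicBoxes hK hK' hx hx')

lemma exists_dyadicBox_mem (j : Fin d → ℕ) {x : Fin d → ℝ} (hx : x ∈ unitCube d) :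
    ∃ K ∈ dyadicBoxes j, x ∈ K := by
  refine ⟨_, ⟨fun l => ⌈x l * 2 ^ j l⌉₊ - 1, fun l => ?_, rfl⟩,
    fun l => mem_dyadicInterval_index (j l) (hx.1 l)⟩
  have : ⌈x l * 2 ^ j l⌉₊ ≤ 2 ^ j l := by
    apply Nat.ceil_le.2
    push_cast
    exact mul_le_of_le_one_left (by positivity) (hx.2 l)
  have h2 : 0 < 2 ^ j l := by positivity
  show ⌈x l * 2 ^ j l⌉₊ - 1 < 2 ^ j l
  omega

lemma exists_parent {j j' : Fin d → ℕ} (hj : j ≤ j') {K : Set (Fin d → ℝ)}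
    (hK : K ∈ dyadicBoxes j') : ∃ K' ∈ dyadicBoxes j, K ⊆ K' := by
  obtain ⟨k, hk, rfl⟩ := hK
  refine ⟨_, ⟨fun l => k l / 2 ^ (j' l - j l), fun l => ?_, rfl⟩,
    fun x hx l => dyadicInterval_subset_parent (hj l) _ (hx l)⟩
  rw [Nat.div_lt_iff_lt_mul (by positivity), ← pow_add, Nat.add_sub_cancel' (hj l)]
  exact hk l

lemma dyadicBoxes_zero : dyadicBoxes (0 : Fin d → ℕ) = {unitCube d} := by
  have h : ∀ k : Fin d → ℕ, (∀ l, k l < 2 ^ (0 : Fin d → ℕ) l) →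
      dyadicBox 0 k = unitCube d := by
    intro k hk
    have hk : ∀ l, k l = 0 := fun l => by simpa using hk l
    ext x
    simp [dyadicBox, hk, dyadicInterval, unitCube, Pi.le_def, forall_and]
  ext K
  constructor
  · rintro ⟨k, hk, rfl⟩
    exact h k hk
  · rintro rfl
    exact ⟨0, by simp, (h 0 (by simp)).symm⟩

lemma subset_unitCube_of_mem_dyadicBoxes {j : Fin d → ℕ} {K : Set (Fin d → ℝ)}
    (hK : K ∈ dyadicBoxes j) : K ⊆ unitCube d := by
  obtain ⟨K', hK', h⟩ := exists_parent (j := 0) (zero_le (a := j)) hK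
  rw [dyadicBoxes_zero] at hK'
  rwa [← Set.mem_singleton_iff.1 hK']

/-! ### Subdivisions of a box and their cardinality -/

lemma finite_dyadicBoxes (j : Fin d → ℕ) : (dyadicBoxes j).Finite := by
  refine ((Fintype.piFinset fun l => Finset.range (2 ^ j l)).finite_toSet.image
    (dyadicBox j)).subset ?_
  rintro K ⟨k, hk, rfl⟩
  exact ⟨k, by simpa using hk, rfl⟩

/-- The dyadic boxes of sidelengths `2^{-j l}` contained in `K`. -/
noncomputable def subBoxes (j : Fin d → ℕ) (K : Set (Fin d → ℝ)) : Finset (Set (Fin d → ℝ)) :=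
  ((finite_dyadicBoxes j).subset (Set.sep_subset _ fun K' => K' ⊆ K)).toFinset

lemma mem_subBoxes {j : Fin d → ℕ} {K K' : Set (Fin d → ℝ)} :
    K' ∈ subBoxes j K ↔ K' ∈ dyadicBoxes j ∧ K' ⊆ K := by
  simp [subBoxes]

lemma pairwiseDisjoint_subBoxes (j : Fin d → ℕ) (K : Set (Fin d → ℝ)) :
    (subBoxes j K : Set (Set (Fin d → ℝ))).PairwiseDisjoint id :=
  (pairwiseDisjoint_dyadicBoxes j).subset fun _ h => (mem_subBoxes.1 h).1

lemma biUnion_subBoxes {j j' : Fin d → ℕ} (hj : j ≤ j') {K : Set (Fin d → ℝ)}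
    (hK : K ∈ dyadicBoxes j) : ⋃ K' ∈ subBoxes j' K, K' = K := by
  refine Set.Subset.antisymm (Set.iUnion₂_subset fun K' h => (mem_subBoxes.1 h).2) fun x hx => ?_
  obtain ⟨K', hK', hxK'⟩ := exists_dyadicBox_mem j' (subset_unitCube_of_mem_dyadicBoxes hK hx)
  obtain ⟨K'', hK'', hsub⟩ := exists_parent hj hK'
  rw [Set.mem_iUnion₂]
  refine ⟨K', mem_subBoxes.2 ⟨hK', ?_⟩, hxK'⟩
  rwa [← eq_of_mem_dyadicBoxes hK'' hK (hsub hxK') hx]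

lemma volume_eq_sum_of_partition {K : Set (Fin d → ℝ)} {m : Finset (Set (Fin d → ℝ))}
    (hm : (m : Set (Set (Fin d → ℝ))).PairwiseDisjoint id) (hmeas : ∀ K' ∈ m, MeasurableSet K')
    (hU : ⋃ K' ∈ m, K' = K) : volume K = ∑ K' ∈ m, volume K' := by
  rw [← hU]
  exact measure_biUnion_finset hm hmeas

/-- The subboxes tile `K` and have equal volume, so the count is a quotient of volumes. -/
lemma card_subBoxes {j j' : Fin d → ℕ} (hj : j ≤ j') {K : Set (Fin d → ℝ)}
    (hK : K ∈ dyadicBoxes j) : (subBoxes j' K).card = 2 ^ (∑ l, (j' l - j l)) := by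
  have h := volume_eq_sum_of_partition (pairwiseDisjoint_subBoxes j' K)
    (fun K' h => measurableSet_of_mem_dyadicBoxes (mem_subBoxes.1 h).1) (biUnion_subBoxes hj hK)
  rw [Finset.sum_congr rfl fun K' h => volume_of_mem_dyadicBoxes (mem_subBoxes.1 h).1,
    volume_of_mem_dyadicBoxes hK, Finset.sum_const, nsmul_eq_mul] at h
  have hs : ∑ l, j' l = ∑ l, (j' l - j l) + ∑ l, j l := by
    rw [← Finset.sum_add_distrib]
    exact Finset.sum_congr rfl fun l _ => (Nat.sub_add_cancel (hj l)).symm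
  rw [hs, pow_add, ← mul_assoc] at h
  have h1 : ((subBoxes j' K).card : ℝ≥0∞) * (2 : ℝ≥0∞)⁻¹ ^ (∑ l, (j' l - j l)) = 1 := by
    refine ((ENNReal.mul_left_inj (c := (2 : ℝ≥0∞)⁻¹ ^ ∑ l, j l) ?_ ?_).1 ?_)
    · exact pow_ne_zero _ (by simp)
    · exact ENNReal.pow_ne_top (by simp)
    · rw [one_mul, ← h]
  rw [← ENNReal.inv_pow, ← div_eq_mul_inv, ENNReal.div_eq_one_iff (by simp) (by simp)] at h1
  exact_mod_cast h1

/-- All dyadic boxes of sidelengths `2^{-j l}`, as a finite set. -/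
noncomputable def grid (j : Fin d → ℕ) : Finset (Set (Fin d → ℝ)) := subBoxes j (unitCube d)

lemma mem_grid {j : Fin d → ℕ} {K : Set (Fin d → ℝ)} : K ∈ grid j ↔ K ∈ dyadicBoxes j :=
  mem_subBoxes.trans ⟨fun h => h.1, fun h => ⟨h, subset_unitCube_of_mem_dyadicBoxes h⟩⟩

lemma coe_grid (j : Fin d → ℕ) : (grid j : Set (Set (Fin d → ℝ))) = dyadicBoxes j := by
  ext K; exact mem_grid

lemma biUnion_grid (j : Fin d → ℕ) : ⋃ K ∈ grid j, K = unitCube d :=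
  biUnion_subBoxes (zero_le (a := j)) (by rw [dyadicBoxes_zero]; rfl)

lemma card_grid (j : Fin d → ℕ) : (grid j).card = 2 ^ ∑ l, j l := by
  have := card_subBoxes (zero_le (a := j)) (K := unitCube d) (by rw [dyadicBoxes_zero]; rfl)
  simpa [grid] using this

lemma volume_unitCube : volume (unitCube d) = 1 := by
  have := volume_of_mem_dyadicBoxes (j := (0 : Fin d → ℕ)) (K := unitCube d)
    (by rw [dyadicBoxes_zero]; rfl)
  simpa using this

/-! ### Refining a partition to a prescribed number of boxes -/

lemma piecewisePoly_subset_of_refines (r : Fin d → ℕ) {𝒦 𝒦' : Set (Set (Fin d → ℝ))}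
    (h : ∀ K' ∈ 𝒦', ∃ K ∈ 𝒦, K' ⊆ K) : piecewisePoly r 𝒦 ⊆ piecewisePoly r 𝒦' := by
  intro t ht K' hK'
  obtain ⟨K, hK, hsub⟩ := h K' hK'
  obtain ⟨P, hP, hPt⟩ := ht K hK
  exact ⟨P, hP, fun x hx => hPt x (hsub hx)⟩

lemma sum_le_mul_of_le {J : ℕ} {j : Fin d → ℕ} (hj : ∀ l, j l ≤ J) : ∑ l, j l ≤ J * d := by
  calc ∑ l, j l ≤ ∑ _l : Fin d, J := Finset.sum_le_sum fun l _ => hj l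
    _ = J * d := by simp [mul_comm]

lemma card_le_of_mem_dyadicPartitions {J n : ℕ} {m : Finset (Set (Fin d → ℝ))}
    (hm : m ∈ dyadicPartitions d J n) : n ≤ 2 ^ (J * d) := by
  obtain ⟨hc, hbox, hdisj, hU⟩ := hm
  have h := volume_eq_sum_of_partition hdisj
    (fun K hK => by obtain ⟨j, -, h⟩ := hbox K hK; exact measurableSet_of_mem_dyadicBoxes h) hU
  have h1 : (m.card : ℝ≥0∞) * (2 : ℝ≥0∞)⁻¹ ^ (J * d) ≤ 1 := by
    rw [← volume_unitCube (d := d), h, ← nsmul_eq_mul, ← Finset.sum_const]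
    refine Finset.sum_le_sum fun K hK => ?_
    obtain ⟨j, hj, hKj⟩ := hbox K hK
    rw [volume_of_mem_dyadicBoxes hKj]
    exact pow_le_pow_of_le_one (by simp) (by simp) (sum_le_mul_of_le hj)
  rw [← ENNReal.inv_pow, ← div_eq_mul_inv, ENNReal.div_le_iff_le_mul (by simp) (by simp),
    one_mul, hc] at h1
  exact_mod_cast h1

/-- If no box could be split, all would have volume exactly `2^{-Jd}`, and total volume `1` would
force `n = 2^{Jd}`. -/
lemma exists_splittable {J n : ℕ} {m : Finset (Set (Fin d → ℝ))}
    (hm : m ∈ dyadicPartitions d J n) (hn : n < 2 ^ (J * d)) :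
    ∃ K ∈ m, ∃ j : Fin d → ℕ, (∀ l, j l ≤ J) ∧ K ∈ dyadicBoxes j ∧ ∃ l, j l < J := by
  by_contra! hcon
  obtain ⟨hc, hbox, hdisj, hU⟩ := hm
  have h := volume_eq_sum_of_partition hdisj
    (fun K hK => by obtain ⟨j, -, h⟩ := hbox K hK; exact measurableSet_of_mem_dyadicBoxes h) hU
  have h1 : (m.card : ℝ≥0∞) * (2 : ℝ≥0∞)⁻¹ ^ (J * d) = 1 := by
    rw [← volume_unitCube (d := d), h, ← nsmul_eq_mul, ← Finset.sum_const]
    refine Finset.sum_congr rfl fun K hK => ?_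
    obtain ⟨j, hj, hKj⟩ := hbox K hK
    have : ∀ l, j l = J := fun l => le_antisymm (hj l) (hcon K hK j hj hKj l)
    rw [volume_of_mem_dyadicBoxes hKj]
    simp [this, mul_comm]
  rw [← ENNReal.inv_pow, ← div_eq_mul_inv, ENNReal.div_eq_one_iff (by simp) (by simp), hc] at h1
  have : n = 2 ^ (J * d) := by exact_mod_cast h1
  omega

-- Halving one box in one direction raises the cardinality by exactly one, so no value between `n`
-- and `2^{Jd}` is skipped.
open Classical in
lemma exists_refine_succ {J n : ℕ} {m : Finset (Set (Fin d → ℝ))}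
    (hm : m ∈ dyadicPartitions d J n) (hn : n < 2 ^ (J * d)) :
    ∃ m' ∈ dyadicPartitions d J (n + 1), ∀ K' ∈ m', ∃ K ∈ m, K' ⊆ K := by
  obtain ⟨K, hK, j, hjJ, hKj, l, hl⟩ := exists_splittable hm hn
  obtain ⟨hc, hbox, hdisj, hU⟩ := hm
  set j' : Fin d → ℕ := Function.update j l (j l + 1) with hj'
  have hjj' : j ≤ j' := by
    intro i
    by_cases hi : i = l
    · subst hi; simp [hj']
    · simp [hj', hi]
  have hj'J : ∀ i, j' i ≤ J := by
    intro i
    by_cases hi : i = l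
    · subst hi; simpa [hj'] using hl
    · simpa [hj', hi] using hjJ i
  have hcard : (subBoxes j' K).card = 2 := by
    rw [card_subBoxes hjj' hKj, Finset.sum_eq_single l]
    · simp [hj']
    · intro i _ hi; simp [hj', hi]
    · simp
  have hdisj2 : ∀ A ∈ m.erase K, ∀ B ∈ subBoxes j' K, Disjoint A B := by
    intro A hA B hB
    exact (hdisj (Finset.mem_of_mem_erase hA) hK (Finset.ne_of_mem_erase hA)).mono_right
      (mem_subBoxes.1 hB).2
  have hd3 : Disjoint (m.erase K) (subBoxes j' K) := by
    rw [Finset.disjoint_left]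
    intro A hA hB
    have hne := nonempty_of_mem_dyadicBoxes (mem_subBoxes.1 hB).1
    exact hne.ne_empty (disjoint_self.1 (hdisj2 A hA A hB))
  refine ⟨m.erase K ∪ subBoxes j' K, ⟨?_, ?_, ?_, ?_⟩, ?_⟩
  · have h1 : 0 < m.card := Finset.card_pos.2 ⟨K, hK⟩
    rw [Finset.card_union_of_disjoint hd3, hcard, Finset.card_erase_of_mem hK]
    omega
  · intro A hA
    rcases Finset.mem_union.1 hA with hA | hA
    · exact hbox A (Finset.mem_of_mem_erase hA)
    · exact ⟨j', hj'J, (mem_subBoxes.1 hA).1⟩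
  · rw [Finset.coe_union, Set.pairwiseDisjoint_union]
    refine ⟨hdisj.subset (by simp), pairwiseDisjoint_subBoxes _ _, ?_⟩
    intro A hA B hB _
    exact hdisj2 A hA B hB
  · rw [Finset.set_biUnion_union, biUnion_subBoxes hjj' hKj, ← hU]
    conv_rhs => rw [← Finset.insert_erase hK, Finset.set_biUnion_insert]
    rw [Set.union_comm]
  · intro A hA
    rcases Finset.mem_union.1 hA with hA | hA
    · exact ⟨A, Finset.mem_of_mem_erase hA, subset_rfl⟩
    · exact ⟨K, hK, (mem_subBoxes.1 hA).2⟩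

lemma piecewisePoly_subset_nonlinSpace (r : Fin d → ℕ) {J n D : ℕ}
    {m : Finset (Set (Fin d → ℝ))} (hm : m ∈ dyadicPartitions d J n) (hnD : n ≤ D)
    (hD : D ≤ 2 ^ (J * d)) :
    piecewisePoly r (m : Set (Set (Fin d → ℝ))) ⊆ nonlinSpace r J D := by
  induction D, hnD using Nat.le_induction generalizing m with
  | base => exact Set.subset_biUnion_of_mem (u := fun m : Finset (Set (Fin d → ℝ)) =>
      piecewisePoly r (m : Set (Set (Fin d → ℝ)))) hm
  | succ D hnD ih =>
    -- The outer induction only separates `n = D` from `n < D`. The chain of refinements is built by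
    -- the inner one.
    suffices ∃ m' ∈ dyadicPartitions d J (D + 1), ∀ K' ∈ m', ∃ K ∈ m, K' ⊆ K by
      obtain ⟨m', hm', h⟩ := this
      exact (piecewisePoly_subset_of_refines r h).trans
        (Set.subset_biUnion_of_mem (u := fun m : Finset (Set (Fin d → ℝ)) =>
          piecewisePoly r (m : Set (Set (Fin d → ℝ)))) hm')
    clear ih
    induction D, hnD using Nat.le_induction with
    | base => exact exists_refine_succ hm (by omega)
    | succ D hnD ih =>
      obtain ⟨m', hm', h⟩ := ih (by omega)
      obtain ⟨m'', hm'', h'⟩ := exists_refine_succ hm' (by omega)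
      refine ⟨m'', hm'', fun K hK => ?_⟩
      obtain ⟨K', hK', h1⟩ := h' K hK
      obtain ⟨K'', hK'', h2⟩ := h K' hK'
      exact ⟨K'', hK'', h1.trans h2⟩

lemma mem_dyadicPartitions_of_le {J J' n : ℕ} (hJ : J ≤ J')
    {m : Finset (Set (Fin d → ℝ))} (hm : m ∈ dyadicPartitions d J n) :
    m ∈ dyadicPartitions d J' n :=
  ⟨hm.1, fun K hK => (hm.2.1 K hK).imp fun _ h => ⟨fun l => (h.1 l).trans hJ, h.2⟩, hm.2.2⟩

/-! ### Sup bounds for polynomials of bounded degree -/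

/-- The multi-indices bounded coordinatewise by `r`. -/
noncomputable def boundedExponents (r : Fin d → ℕ) : Finset (Fin d →₀ ℕ) :=
  Finset.Iic (Finsupp.equivFunOnFinite.symm r)

lemma mem_boundedExponents {r : Fin d → ℕ} {i : Fin d →₀ ℕ} :
    i ∈ boundedExponents r ↔ ∀ l, i l ≤ r l := by
  simp [boundedExponents, Finsupp.le_def]

/-- The polynomial with coefficients `c`, as a function. -/
noncomputable def coeffEval (r : Fin d → ℕ) (c : boundedExponents r → ℝ) (x : Fin d → ℝ) : ℝ :=
  ∑ i, c i * ∏ l, x l ^ (i.1 l)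

lemma continuous_coeffEval (r : Fin d → ℕ) :
    Continuous fun z : (boundedExponents r → ℝ) × (Fin d → ℝ) => coeffEval r z.1 z.2 := by
  unfold coeffEval
  fun_prop

lemma eval_eq_coeffEval {r : Fin d → ℕ} {P : MvPolynomial (Fin d) ℝ}
    (hP : ∀ l, P.degreeOf l ≤ r l) (x : Fin d → ℝ) :
    MvPolynomial.eval x P = coeffEval r (fun i => P.coeff i.1) x := by
  rw [MvPolynomial.eval_eq', coeffEval,
    Finset.sum_coe_sort (boundedExponents r) fun i => P.coeff i * ∏ l, x l ^ i l]
  refine Finset.sum_subset (fun i hi => mem_boundedExponents.2 fun l =>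
    MvPolynomial.degreeOf_le_iff.1 (hP l) i hi) fun i _ hi => ?_
  rw [MvPolynomial.notMem_support_iff.1 hi, zero_mul]

lemma coeffEval_smul (r : Fin d → ℕ) (t : ℝ) (c : boundedExponents r → ℝ) (x : Fin d → ℝ) :
    coeffEval r (t • c) x = t * coeffEval r c x := by
  simp [coeffEval, Finset.mul_sum, mul_assoc]

lemma abs_coeffEval_le (r : Fin d → ℕ) (c : boundedExponents r → ℝ) {x : Fin d → ℝ}
    (hx : x ∈ unitCube d) : |coeffEval r c x| ≤ (boundedExponents r).card * ‖c‖ := by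
  calc |coeffEval r c x| ≤ ∑ i, |c i * ∏ l, x l ^ (i.1 l)| := Finset.abs_sum_le_sum_abs _ _
    _ ≤ ∑ _i : boundedExponents r, ‖c‖ := by
        refine Finset.sum_le_sum fun i _ => ?_
        rw [abs_mul]
        have h1 : |∏ l, x l ^ (i.1 l)| ≤ 1 := by
          rw [Finset.abs_prod]
          refine Finset.prod_le_one (fun l _ => abs_nonneg _) fun l _ => ?_
          rw [abs_pow, abs_of_nonneg (hx.1 l)]
          exact pow_le_one₀ (hx.1 l) (hx.2 l)
        exact (mul_le_of_le_one_right (abs_nonneg _) h1).trans (norm_le_pi_norm c i)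
    _ = (boundedExponents r).card * ‖c‖ := by simp

lemma coeff_eq_zero_of_coeffEval_eq_zero {r : Fin d → ℕ} {c : boundedExponents r → ℝ}
    (h : ∀ x ∈ Set.univ.pi fun _ : Fin d => Set.Ioo (0 : ℝ) 1, coeffEval r c x = 0) : c = 0 := by
  classical
  set P : MvPolynomial (Fin d) ℝ := ∑ i, MvPolynomial.monomial i.1 (c i) with hP
  have hcoeff : ∀ i, P.coeff i.1 = c i := by
    intro i
    rw [hP, MvPolynomial.coeff_sum, Finset.sum_eq_single i]
    · simp
    · intro i' _ hne
      rw [MvPolynomial.coeff_monomial, if_neg fun h => hne (Subtype.ext h)]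
    · simp
  have heval : ∀ x, MvPolynomial.eval x P = coeffEval r c x := by
    intro x
    simp only [hP, map_sum, MvPolynomial.eval_monomial, coeffEval]
    refine Finset.sum_congr rfl fun i _ => ?_
    rw [Finsupp.prod_fintype _ _ (by simp)]
  have h0 : P = 0 := MvPolynomial.funext_set (fun _ => Set.Ioo (0 : ℝ) 1)
    (fun _ => Set.Ioo_infinite one_pos) fun x hx => by rw [heval, h x hx, map_zero]
  ext i
  rw [← hcoeff, h0]
  simp

/-- For `p < 1` the integral does not come from a norm, so equivalence of norms is replaced by its
proof: the integral is continuous and `p`-homogeneous in the coefficients, and positive on their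
compact unit sphere. -/
lemma exists_coeff_bound (r : Fin d → ℕ) {p : ℝ} (hp : 0 < p) :
    ∃ m : ℝ, 0 < m ∧ ∀ c : boundedExponents r → ℝ,
      m * ‖c‖ ^ p ≤ ∫ y in unitCube d, |coeffEval r c y| ^ p := by
  have hcont : ∀ c : boundedExponents r → ℝ, Continuous fun y => |coeffEval r c y| ^ p :=
    fun c => (((continuous_coeffEval r).comp (Continuous.prodMk_right c)).abs).rpow_const
      fun _ => Or.inr hp.le
  have hN : Continuous fun c : boundedExponents r → ℝ =>
      ∫ y in unitCube d, |coeffEval r c y| ^ p :=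
    continuous_parametric_integral_of_continuous
      (((continuous_coeffEval r).abs).rpow_const fun _ => Or.inr hp.le) isCompact_Icc
  have hpos : ∀ c ∈ Metric.sphere (0 : boundedExponents r → ℝ) 1,
      0 < ∫ y in unitCube d, |coeffEval r c y| ^ p := by
    intro c hc
    have hnn : ∀ y, 0 ≤ |coeffEval r c y| ^ p := fun y => by positivity
    refine lt_of_le_of_ne (integral_nonneg hnn) fun h0 => ?_
    have h1 := (integral_eq_zero_iff_of_nonneg hnn
      ((hcont c).continuousOn.integrableOn_compact isCompact_Icc)).1 h0.symm
    have hsub : (Set.univ.pi fun _ : Fin d => Set.Ioo (0 : ℝ) 1) ⊆ unitCube d :=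
      fun y hy => ⟨fun l => (hy l trivial).1.le, fun l => (hy l trivial).2.le⟩
    have h2 := Measure.eqOn_open_of_ae_eq (ae_restrict_of_ae_restrict_of_subset hsub h1)
      (isOpen_set_pi Set.finite_univ fun _ _ => isOpen_Ioo) (hcont c).continuousOn
      continuousOn_const
    have h3 : c = 0 := coeff_eq_zero_of_coeffEval_eq_zero fun x hx => by
      have := h2 hx
      simp only [Pi.zero_apply] at this
      rw [Real.rpow_eq_zero (abs_nonneg _) hp.ne'] at this
      exact abs_eq_zero.1 this
    simp [h3] at hc
  obtain ⟨m, hm, hmle⟩ := (isCompact_sphere (0 : boundedExponents r → ℝ) 1).exists_forall_le'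
    hN.continuousOn hpos
  refine ⟨m, hm, fun c => ?_⟩
  rcases eq_or_ne c 0 with rfl | hc
  · simp only [norm_zero, Real.zero_rpow hp.ne', mul_zero]
    exact integral_nonneg fun y => by positivity
  · have hc' : 0 < ‖c‖ := norm_pos_iff.2 hc
    have h1 := hmle (‖c‖⁻¹ • c) (by simp [norm_smul, hc'.ne'])
    simp only [coeffEval_smul, abs_mul] at h1
    simp only [Real.mul_rpow (abs_nonneg _) (abs_nonneg _)] at h1
    rw [integral_const_mul, abs_of_pos (inv_pos.2 hc'), Real.inv_rpow hc'.le, inv_mul_eq_div,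
      le_div_iff₀ (by positivity)] at h1
    exact h1

lemma exists_unitCube_sup_bound (r : Fin d → ℕ) {p : ℝ} (hp : 0 < p) :
    ∃ C : ℝ≥0∞, C ≠ ∞ ∧ ∀ P : MvPolynomial (Fin d) ℝ, (∀ l, P.degreeOf l ≤ r l) →
      ∀ x ∈ unitCube d, ‖MvPolynomial.eval x P‖ₑ ^ p ≤
        C * ∫⁻ y in unitCube d, ‖MvPolynomial.eval y P‖ₑ ^ p := by
  obtain ⟨m, hm, h⟩ := exists_coeff_bound r hp
  refine ⟨ENNReal.ofReal (((boundedExponents r).card : ℝ) ^ p / m), ENNReal.ofReal_ne_top,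
    fun P hP x hx => ?_⟩
  set c : boundedExponents r → ℝ := fun i => P.coeff i.1
  have hcont : Continuous fun y => |coeffEval r c y| ^ p :=
    (((continuous_coeffEval r).comp (Continuous.prodMk_right c)).abs).rpow_const
      fun _ => Or.inr hp.le
  have hen : ∀ y, ‖MvPolynomial.eval y P‖ₑ ^ p = ENNReal.ofReal (|coeffEval r c y| ^ p) := by
    intro y
    rw [eval_eq_coeffEval hP, Real.enorm_eq_ofReal_abs,
      ENNReal.ofReal_rpow_of_nonneg (abs_nonneg _) hp.le]
  have hint : IntegrableOn (fun y => |coeffEval r c y| ^ p) (unitCube d) :=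
    hcont.continuousOn.integrableOn_compact isCompact_Icc
  simp only [hen]
  rw [← ofReal_integral_eq_lintegral_ofReal hint
    (Filter.Eventually.of_forall fun y => by positivity), ← ENNReal.ofReal_mul (by positivity)]
  refine ENNReal.ofReal_le_ofReal ?_
  calc |coeffEval r c x| ^ p ≤ ((boundedExponents r).card * ‖c‖) ^ p :=
        Real.rpow_le_rpow (abs_nonneg _) (abs_coeffEval_le r c hx) hp.le
    _ = ((boundedExponents r).card : ℝ) ^ p / m * (m * ‖c‖ ^ p) := by
        rw [Real.mul_rpow (by positivity) (norm_nonneg _)]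
        field_simp
    _ ≤ _ := mul_le_mul_of_nonneg_left (h c) (by positivity)

/-- Precomposition of a polynomial with the coordinatewise affine map `y ↦ a + b y`. -/
noncomputable def affineComp (a b : Fin d → ℝ) (P : MvPolynomial (Fin d) ℝ) :
    MvPolynomial (Fin d) ℝ :=
  MvPolynomial.bind₁ (fun l => MvPolynomial.C (a l) + MvPolynomial.C (b l) * MvPolynomial.X l) P

lemma eval_affineComp (a b : Fin d → ℝ) (P : MvPolynomial (Fin d) ℝ) (y : Fin d → ℝ) :
    MvPolynomial.eval y (affineComp a b P) = MvPolynomial.eval (a + b * y) P := by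
  rw [affineComp, ← MvPolynomial.coe_aeval_eq_eval, RingHom.coe_coe, MvPolynomial.aeval_bind₁,
    ← MvPolynomial.coe_aeval_eq_eval, RingHom.coe_coe]
  congr 2
  ext l
  simp

lemma degreeOf_affineComp_le (a b : Fin d → ℝ) (P : MvPolynomial (Fin d) ℝ) (l : Fin d) :
    (affineComp a b P).degreeOf l ≤ P.degreeOf l := by
  conv_lhs => rw [MvPolynomial.as_sum P]
  rw [affineComp, map_sum]
  refine (MvPolynomial.degreeOf_sum_le _ _ _).trans (Finset.sup_le fun i hi => ?_)
  rw [MvPolynomial.bind₁_monomial]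
  refine (MvPolynomial.degreeOf_C_mul_le _ _ _).trans
    ((MvPolynomial.degreeOf_prod_le _ _ _).trans ?_)
  have hlin : ∀ l', MvPolynomial.degreeOf l
      (MvPolynomial.C (a l') + MvPolynomial.C (b l') * MvPolynomial.X l') ≤
        if l = l' then 1 else 0 := by
    intro l'
    refine (MvPolynomial.degreeOf_add_le _ _ _).trans (max_le ?_ ?_)
    · simp
    · refine (MvPolynomial.degreeOf_C_mul_le _ _ _).trans ?_
      rw [MvPolynomial.degreeOf_X]
  calc _ ≤ ∑ l' ∈ i.support, i l' * if l = l' then 1 else 0 :=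
        Finset.sum_le_sum fun l' _ => (MvPolynomial.degreeOf_pow_le _ _ _).trans
          (Nat.mul_le_mul_left _ (hlin l'))
    _ ≤ i l := by
        simp
        split_ifs <;> simp
    _ ≤ _ := MvPolynomial.monomial_le_degreeOf l hi

lemma lintegral_eq_mul_lintegral_affine (a b : Fin d → ℝ) (hb : ∀ l, 0 < b l)
    {f : (Fin d → ℝ) → ℝ≥0∞} (hf : Measurable f) :
    ∫⁻ x, f x = ENNReal.ofReal (∏ l, b l) * ∫⁻ y, f (a + b * y) := by
  have hdet : (Matrix.diagonal b).det ≠ 0 := by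
    rw [Matrix.det_diagonal]; exact (Finset.prod_pos fun l _ => hb l).ne'
  have hmap := Real.smul_map_diagonal_volume_pi hdet
  rw [Matrix.det_diagonal, abs_of_pos (Finset.prod_pos fun l _ => hb l)] at hmap
  rw [← lintegral_add_left_eq_self f a]
  conv_lhs => rw [← hmap]
  rw [lintegral_smul_measure, smul_eq_mul, lintegral_map (by fun_prop)
    (LinearMap.continuous_on_pi _).measurable]
  congr 1
  refine lintegral_congr fun y => ?_
  congr 2
  ext l
  simp [Matrix.toLin'_apply, Matrix.mulVec_diagonal]

/-- A polynomial of bounded coordinate degrees is bounded on a dyadic box by its normalised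
`L_p`-quasi-norm on that box, with a constant independent of the box. -/
lemma exists_dyadicBox_sup_bound (r : Fin d → ℕ) {p : ℝ} (hp : 0 < p) :
    ∃ C : ℝ≥0∞, C ≠ ∞ ∧ ∀ P : MvPolynomial (Fin d) ℝ, (∀ l, P.degreeOf l ≤ r l) →
      ∀ (j k : Fin d → ℕ), ∀ x ∈ dyadicBox j k,
        ‖MvPolynomial.eval x P‖ₑ ^ p * volume (dyadicBox j k) ≤
          C * ∫⁻ y in dyadicBox j k, ‖MvPolynomial.eval y P‖ₑ ^ p := by
  obtain ⟨C, hC, h⟩ := exists_unitCube_sup_bound r hp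
  refine ⟨C, hC, fun P hP j k x hx => ?_⟩
  set b : Fin d → ℝ := fun l => ((2 : ℝ) ^ j l)⁻¹ with hb
  set a : Fin d → ℝ := fun l => k l * b l with ha
  have hb0 : ∀ l, 0 < b l := fun l => by simp only [hb]; positivity
  set y : Fin d → ℝ := fun l => (x l - a l) / b l with hy
  have hxy : x = a + b * y := by
    ext l
    simp only [hy, Pi.add_apply, Pi.mul_apply]
    rw [mul_div_cancel₀ _ (hb0 l).ne']
    ring
  have hyc : y ∈ unitCube d := by
    refine ⟨fun l => ?_, fun l => ?_⟩
    · exact div_nonneg (sub_nonneg.2 (dyadicInterval_subset_Icc _ _ (hx l)).1) (hb0 l).le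
    · have := (dyadicInterval_subset_Icc _ _ (hx l)).2
      simp only [hy, Pi.one_apply]
      rw [div_le_one (hb0 l)]
      simp only [ha, hb] at *
      linarith
  have hQ := h (affineComp a b P) (fun l => (degreeOf_affineComp_le a b P l).trans (hP l)) y hyc
  simp only [eval_affineComp] at hQ
  rw [← hxy] at hQ
  have hvol : volume (dyadicBox j k) = ENNReal.ofReal (∏ l, b l) := by
    rw [volume_dyadicBox, ENNReal.ofReal_prod_of_nonneg fun l _ => (hb0 l).le,
      ← Finset.prod_pow_eq_pow_sum]
    refine Finset.prod_congr rfl fun l _ => ?_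
    rw [hb, ENNReal.ofReal_inv_of_pos (by positivity), ENNReal.ofReal_pow (by norm_num),
      ENNReal.inv_pow]
    simp
  have hmeas : Measurable fun y => ‖MvPolynomial.eval y P‖ₑ ^ p :=
    ((MvPolynomial.continuous_eval P).measurable.enorm).pow_const p
  -- The affine map sends the half-open cube into the box whatever the index, whereas the closed
  -- cube may overshoot it. The difference is a null set.
  have hae : (Set.univ.pi fun l : Fin d => Set.Ioc ((0 : Fin d → ℝ) l) ((1 : Fin d → ℝ) l))
      =ᵐ[volume] unitCube d := Measure.univ_pi_Ioc_ae_eq_Icc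
  have hint : volume (dyadicBox j k) *
      ∫⁻ y in unitCube d, ‖MvPolynomial.eval (a + b * y) P‖ₑ ^ p ≤
        ∫⁻ y in dyadicBox j k, ‖MvPolynomial.eval y P‖ₑ ^ p := by
    rw [← lintegral_indicator (measurableSet_dyadicBox j k),
      lintegral_eq_mul_lintegral_affine a b hb0
        (hmeas.indicator (measurableSet_dyadicBox j k)), ← hvol, ← setLIntegral_congr hae,
      ← lintegral_indicator (MeasurableSet.univ_pi fun _ => measurableSet_Ioc)]
    gcongr with y
    by_cases hy' : y ∈ Set.univ.pi fun l : Fin d =>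
        Set.Ioc ((0 : Fin d → ℝ) l) ((1 : Fin d → ℝ) l)
    · have hmem : a + b * y ∈ dyadicBox j k := by
        intro l
        have h1 : 0 < y l := (hy' l trivial).1
        have h2 : y l ≤ 1 := (hy' l trivial).2
        apply Ioc_subset_dyadicInterval
        change k l * b l < k l * b l + b l * y l ∧ k l * b l + b l * y l ≤ (k l + 1) * b l
        constructor
        · have := mul_pos (hb0 l) h1
          linarith
        · have := mul_le_of_le_one_right (hb0 l).le h2
          linarith
      rw [Set.indicator_of_mem hy', Set.indicator_of_mem hmem]
    · rw [Set.indicator_of_notMem hy']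
      exact zero_le
  calc _ ≤ (C * ∫⁻ y in unitCube d, ‖MvPolynomial.eval (a + b * y) P‖ₑ ^ p) *
        volume (dyadicBox j k) := by gcongr
    _ = C * (volume (dyadicBox j k) *
        ∫⁻ y in unitCube d, ‖MvPolynomial.eval (a + b * y) P‖ₑ ^ p) := by ring
    _ ≤ _ := by gcongr

/-! ### Tree partitions resolving marked boxes -/

open Classical in
lemma sum_card_filter_subset_le {S T : Finset (Set (Fin d → ℝ))}
    {e : Fin d → ℕ} (hT : T ⊆ grid e)
    (hS : (S : Set (Set (Fin d → ℝ))).PairwiseDisjoint id) {B : Set (Fin d → ℝ)}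
    (hSB : ∀ B' ∈ S, B' ⊆ B) :
    ∑ B' ∈ S, (T.filter (· ⊆ B')).card ≤ (T.filter (· ⊆ B)).card := by
  rw [← Finset.card_biUnion]
  · refine Finset.card_le_card fun M hM => ?_
    obtain ⟨B', hB', hM⟩ := Finset.mem_biUnion.1 hM
    rw [Finset.mem_filter] at hM ⊢
    exact ⟨hM.1, hM.2.trans (hSB B' hB')⟩
  · intro B₁ h₁ B₂ h₂ hne
    rw [Function.onFun, Finset.disjoint_left]
    intro M hM₁ hM₂
    rw [Finset.mem_filter] at hM₁ hM₂
    obtain ⟨x, hx⟩ := nonempty_of_mem_dyadicBoxes (mem_grid.1 (hT hM₁.1))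
    exact Set.disjoint_left.1 (hS h₁ h₂ hne) (hM₁.2 hx) (hM₂.2 hx)

lemma biUnion_partition {S : Finset (Set (Fin d → ℝ))}
    (hS : (S : Set (Set (Fin d → ℝ))).PairwiseDisjoint id)
    {m : Set (Fin d → ℝ) → Finset (Set (Fin d → ℝ))}
    (hm : ∀ B ∈ S, (m B : Set (Set (Fin d → ℝ))).PairwiseDisjoint id ∧ ⋃ K ∈ m B, K = B) :
    (⋃ B ∈ S, (m B : Set (Set (Fin d → ℝ)))).PairwiseDisjoint id := by
  intro K hK K' hK' hne
  obtain ⟨B, hB, hKB⟩ := Set.mem_iUnion₂.1 hK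
  obtain ⟨B', hB', hKB'⟩ := Set.mem_iUnion₂.1 hK'
  have sub : ∀ B ∈ S, ∀ K ∈ m B, K ⊆ B := fun B hB K hK => by
    conv_rhs => rw [← (hm B hB).2]
    exact Set.subset_biUnion_of_mem (u := id) hK
  by_cases h : B = B'
  · subst h
    exact (hm B hB).1 hKB hKB' hne
  · exact (hS hB hB' h).mono (sub B hB K hKB) (sub B' hB' K' hKB')

open Classical in
/-- The leaves of the smallest subtree, rooted at `B`, of the tree of dyadic boxes of sidelengths
`2^{-e n l}` that resolves all the marked boxes. -/
lemma exists_leaf_partition {e : ℕ → Fin d → ℕ} (hmono : Monotone e)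
    (hstep : ∀ n l, e (n + 1) l ≤ e n l + 1) {Λ : ℕ → Finset (Set (Fin d → ℝ))}
    (hΛ : ∀ n, Λ n ⊆ grid (e n)) (J i k : ℕ) (hk : k + i = J) :
    ∀ B ∈ grid (e k), ∃ m : Finset (Set (Fin d → ℝ)),
      (∀ K ∈ m, ∃ n ≤ J, K ∈ grid (e n)) ∧
      (m : Set (Set (Fin d → ℝ))).PairwiseDisjoint id ∧ ⋃ K ∈ m, K = B ∧
      (∀ n ∈ Finset.Ioc k J, ∀ M ∈ Λ n, ∀ K ∈ m, K ⊆ M ∨ Disjoint K M) ∧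
      m.card ≤ 1 + 2 ^ d * ∑ n ∈ Finset.Ioc k J, (n - k) * ((Λ n).filter (· ⊆ B)).card := by
  induction i generalizing k with
  | zero =>
    intro B hB
    refine ⟨{B}, ?_, by simp, by simp, ?_, by simp⟩
    · simpa using ⟨k, by omega, hB⟩
    · intro n hn; simp at hn; omega
  | succ i ih =>
    intro B hB
    -- With no mark strictly below its level, `B` is itself a leaf. Any later marked box then has
    -- its level `k` ancestor different from `B`, hence is disjoint from it.
    by_cases hmark : ∀ n ∈ Finset.Ioc k J, (Λ n).filter (· ⊆ B) = ∅
    · refine ⟨{B}, ?_, by simp, by simp, ?_, by simp⟩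
      · simpa using ⟨k, by omega, hB⟩
      · intro n hn M hM K hK
        obtain rfl := Finset.mem_singleton.1 hK
        right
        rw [Set.disjoint_left]
        intro x hxK hxM
        obtain ⟨B', hB', hMB'⟩ := exists_parent (hmono (Finset.mem_Ioc.1 hn).1.le)
          (mem_grid.1 (hΛ n hM))
        have := eq_of_mem_dyadicBoxes hB' (mem_grid.1 hB) (hMB' hxM) hxK
        subst this
        exact Finset.notMem_empty M (hmark n hn ▸ Finset.mem_filter.2 ⟨hM, hMB'⟩)
    · push Not at hmark
      obtain ⟨n₀, hn₀, M₀, hM₀⟩ := hmark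
      have hle : e k ≤ e (k + 1) := hmono (Nat.le_succ k)
      choose! m hm1 hm2 hm3 hm4 hm5 using ih (k + 1) (by omega)
      set S := subBoxes (e (k + 1)) B with hSdef
      have hSg : ∀ B' ∈ S, B' ∈ grid (e (k + 1)) := fun B' h => mem_grid.2 (mem_subBoxes.1 h).1
      have hSd : (S : Set (Set (Fin d → ℝ))).PairwiseDisjoint id := pairwiseDisjoint_subBoxes _ _
      refine ⟨S.biUnion m, ?_, ?_, ?_, ?_, ?_⟩
      · intro K hK
        obtain ⟨B', hB', hK⟩ := Finset.mem_biUnion.1 hK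
        exact hm1 B' (hSg B' hB') K hK
      · rw [Finset.coe_biUnion]
        exact biUnion_partition hSd fun B' h => ⟨hm2 B' (hSg B' h), hm3 B' (hSg B' h)⟩
      · rw [Finset.set_biUnion_biUnion]
        conv_rhs => rw [← biUnion_subBoxes hle (mem_grid.1 hB)]
        exact Set.iUnion₂_congr fun B' h => hm3 B' (hSg B' h)
      · intro n hn M hM K hK
        obtain ⟨B', hB', hK⟩ := Finset.mem_biUnion.1 hK
        rw [Finset.mem_Ioc] at hn
        -- The induction hypothesis covers the levels beyond `k + 1` only. Marks of level `k + 1`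
        -- lie in the same grid as the children, so each child equals such a mark or misses it.
        by_cases hn1 : n = k + 1
        · subst hn1
          have hKB' : K ⊆ B' := by
            conv_rhs => rw [← hm3 B' (hSg B' hB')]
            exact Set.subset_biUnion_of_mem (u := id) hK
          by_cases hMB : B' = M
          · exact Or.inl (hMB ▸ hKB')
          · exact Or.inr ((pairwiseDisjoint_dyadicBoxes _ (mem_grid.1 (hSg B' hB'))
              (mem_grid.1 (hΛ _ hM)) hMB).mono_left hKB')
        · exact hm4 B' (hSg B' hB') n (Finset.mem_Ioc.2 ⟨by omega, hn.2⟩) M hM K hK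
      · have hcardS : S.card ≤ 2 ^ d := by
          rw [hSdef, card_subBoxes hle (mem_grid.1 hB)]
          refine Nat.pow_le_pow_right (by norm_num) ?_
          calc _ ≤ ∑ _l : Fin d, 1 := Finset.sum_le_sum fun l _ => by
                have := hstep k l; omega
            _ = d := by simp
        have hsub : Finset.Ioc (k + 1) J ⊆ Finset.Ioc k J := Finset.Ioc_subset_Ioc_left (by omega)
        -- A node is split only if it contains a mark, and that mark pays for its at most `2^d`
        -- children. A mark of level `n` thus pays once for each level from `k` to `n - 1`, whence
        -- the weight `n - k`.
        have h1 : 1 ≤ ∑ n ∈ Finset.Ioc k J, ((Λ n).filter (· ⊆ B)).card :=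
          (Finset.card_pos.2 ⟨M₀, hM₀⟩).trans_le (Finset.single_le_sum
            (f := fun n => ((Λ n).filter (· ⊆ B)).card) (fun _ _ => Nat.zero_le _) hn₀)
        calc (S.biUnion m).card ≤ ∑ B' ∈ S, (m B').card := Finset.card_biUnion_le
          _ ≤ ∑ B' ∈ S, (1 + 2 ^ d * ∑ n ∈ Finset.Ioc (k + 1) J,
                (n - (k + 1)) * ((Λ n).filter (· ⊆ B')).card) :=
              Finset.sum_le_sum fun B' h => hm5 B' (hSg B' h)
          _ = S.card + 2 ^ d * ∑ n ∈ Finset.Ioc (k + 1) J,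
                (n - (k + 1)) * ∑ B' ∈ S, ((Λ n).filter (· ⊆ B')).card := by
              rw [Finset.sum_add_distrib, ← Finset.mul_sum, Finset.sum_comm]
              simp [Finset.mul_sum]
          _ ≤ 2 ^ d * ∑ n ∈ Finset.Ioc k J, ((Λ n).filter (· ⊆ B)).card +
                2 ^ d * ∑ n ∈ Finset.Ioc k J, (n - (k + 1)) * ((Λ n).filter (· ⊆ B)).card := by
              refine add_le_add (hcardS.trans (Nat.le_mul_of_pos_right _ h1))
                (Nat.mul_le_mul_left _ ?_)
              refine (Finset.sum_le_sum fun n _ => Nat.mul_le_mul_left _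
                (sum_card_filter_subset_le (hΛ n) hSd
                  fun B' h => (mem_subBoxes.1 h).2)).trans ?_
              exact Finset.sum_le_sum_of_subset hsub
          _ = 2 ^ d * ∑ n ∈ Finset.Ioc k J, (n - k) * ((Λ n).filter (· ⊆ B)).card := by
              rw [← mul_add, ← Finset.sum_add_distrib]
              congr 1
              refine Finset.sum_congr rfl fun n hn => ?_
              rw [Finset.mem_Ioc] at hn
              obtain ⟨t, rfl⟩ : ∃ t, n = k + 1 + t := ⟨n - (k + 1), by omega⟩
              rw [show k + 1 + t - (k + 1) = t by omega, show k + 1 + t - k = t + 1 by omega]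
              ring
          _ ≤ _ := Nat.le_add_left _ _

open Classical in
/-- A partition refining the grid of level `k` and resolving the marked boxes of the levels
`k + 1, …, J`. -/
lemma exists_adapted_partition {e : ℕ → Fin d → ℕ} (hmono : Monotone e)
    (hstep : ∀ n l, e (n + 1) l ≤ e n l + 1) (hle : ∀ n l, e n l ≤ n)
    {Λ : ℕ → Finset (Set (Fin d → ℝ))}
    (hΛ : ∀ n, Λ n ⊆ grid (e n)) {J k : ℕ} (hk : k ≤ J) :
    ∃ m : Finset (Set (Fin d → ℝ)), m ∈ dyadicPartitions d J m.card ∧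
      (∀ K ∈ m, ∃ B ∈ grid (e k), K ⊆ B) ∧
      (∀ n ∈ Finset.Ioc k J, ∀ M ∈ Λ n, ∀ K ∈ m, K ⊆ M ∨ Disjoint K M) ∧
      m.card ≤ (grid (e k)).card + 2 ^ d * ∑ n ∈ Finset.Ioc k J, (n - k) * (Λ n).card := by
  choose! m hm1 hm2 hm3 hm4 hm5 using
    exists_leaf_partition hmono hstep hΛ J (J - k) k (by omega)
  have hSd : (grid (e k) : Set (Set (Fin d → ℝ))).PairwiseDisjoint id :=
    pairwiseDisjoint_subBoxes _ _
  refine ⟨(grid (e k)).biUnion m, ⟨rfl, ?_, ?_, ?_⟩, ?_, ?_, ?_⟩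
  · intro K hK
    obtain ⟨B, hB, hK⟩ := Finset.mem_biUnion.1 hK
    obtain ⟨n, hn, h⟩ := hm1 B hB K hK
    exact ⟨e n, fun l => (hle n l).trans hn, mem_grid.1 h⟩
  · rw [Finset.coe_biUnion]
    exact biUnion_partition hSd fun B h => ⟨hm2 B h, hm3 B h⟩
  · rw [Finset.set_biUnion_biUnion, ← biUnion_grid (e k)]
    exact Set.iUnion₂_congr fun B h => hm3 B h
  · intro K hK
    obtain ⟨B, hB, hK⟩ := Finset.mem_biUnion.1 hK
    refine ⟨B, hB, ?_⟩
    conv_rhs => rw [← hm3 B hB]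
    exact Set.subset_biUnion_of_mem (u := id) hK
  · intro n hn M hM K hK
    obtain ⟨B, hB, hK⟩ := Finset.mem_biUnion.1 hK
    exact hm4 B hB n hn M hM K hK
  · calc _ ≤ ∑ B ∈ grid (e k), (m B).card := Finset.card_biUnion_le
      _ ≤ ∑ B ∈ grid (e k), (1 + 2 ^ d * ∑ n ∈ Finset.Ioc k J,
            (n - k) * ((Λ n).filter (· ⊆ B)).card) := Finset.sum_le_sum hm5
      _ = (grid (e k)).card + 2 ^ d * ∑ n ∈ Finset.Ioc k J,
            (n - k) * ∑ B ∈ grid (e k), ((Λ n).filter (· ⊆ B)).card := by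
          rw [Finset.sum_add_distrib, ← Finset.mul_sum, Finset.sum_comm]
          simp [Finset.mul_sum]
      _ ≤ _ := by
          gcongr with n hn
          refine (sum_card_filter_subset_le (hΛ n) hSd
            fun B h => Set.subset_univ B).trans ?_
          exact Finset.card_filter_le _ _

/-! ### Growth of the anisotropic grids -/

/-- The dyadic exponents of the sidelengths of the anisotropic grid of level `n`. -/
noncomputable def anisoExp (σ : Fin d → ℝ) (n : ℕ) (l : Fin d) : ℕ :=
  ⌊(n : ℝ) * minSmooth σ / σ l⌋₊

/-- The growth rate `(min σ) ∑ 1 / σ_l` of the logarithm of the number of anisotropic boxes. -/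
noncomputable def growthRate (σ : Fin d → ℝ) : ℝ := minSmooth σ * ∑ l, 1 / σ l

section

variable {σ : Fin d → ℝ}

lemma minSmooth_le (σ : Fin d → ℝ) (l : Fin d) : minSmooth σ ≤ σ l :=
  ciInf_le (Set.finite_range σ).bddBelow l

lemma minSmooth_pos (hσ : ∀ l, 0 < σ l) (hd : 1 ≤ d) : 0 < minSmooth σ := by
  have : Nonempty (Fin d) := ⟨⟨0, hd⟩⟩
  obtain ⟨l, hl⟩ := exists_eq_ciInf_of_finite (f := σ)
  rw [minSmooth, ← hl]
  exact hσ l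

lemma minSmooth_nonneg (hσ : ∀ l, 0 < σ l) : 0 ≤ minSmooth σ :=
  Real.iInf_nonneg fun l => (hσ l).le

lemma monotone_anisoExp (hσ : ∀ l, 0 < σ l) : Monotone (anisoExp σ) := by
  intro n n' h l
  refine Nat.floor_mono ?_
  have := minSmooth_nonneg hσ
  have := hσ l
  gcongr

/-- Since `min σ / σ_l ≤ 1`, one level adds at most one halving per direction. A box therefore has
at most `2^d` children. -/
lemma anisoExp_succ_le (hσ : ∀ l, 0 < σ l) (n : ℕ) (l : Fin d) :
    anisoExp σ (n + 1) l ≤ anisoExp σ n l + 1 := by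
  have h0 := minSmooth_nonneg hσ
  have h1 : minSmooth σ / σ l ≤ 1 := (div_le_one (hσ l)).2 (minSmooth_le σ l)
  rw [anisoExp, anisoExp, ← Nat.floor_add_one (div_nonneg (by positivity) (hσ l).le)]
  refine Nat.floor_mono ?_
  push_cast
  rw [add_mul, add_div, one_mul]
  linarith

lemma anisoExp_le (hσ : ∀ l, 0 < σ l) (n : ℕ) (l : Fin d) : anisoExp σ n l ≤ n := by
  have h1 : minSmooth σ / σ l ≤ 1 := (div_le_one (hσ l)).2 (minSmooth_le σ l)
  refine Nat.floor_le_of_le ?_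
  rw [mul_div_assoc]
  exact mul_le_of_le_one_right (by positivity) h1

lemma sum_anisoExp_le (hσ : ∀ l, 0 < σ l) (n : ℕ) :
    ((∑ l, anisoExp σ n l : ℕ) : ℝ) ≤ n * growthRate σ := by
  have h0 := minSmooth_nonneg hσ
  rw [growthRate, Finset.mul_sum, Finset.mul_sum]
  push_cast
  refine Finset.sum_le_sum fun l _ => (Nat.floor_le (div_nonneg (by positivity)
    (hσ l).le)).trans_eq ?_
  ring

lemma card_grid_anisoExp_le (hσ : ∀ l, 0 < σ l) (n : ℕ) :
    ((grid (anisoExp σ n)).card : ℝ) ≤ (2 : ℝ) ^ (n * growthRate σ) := by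
  rw [card_grid]
  push_cast
  rw [← Real.rpow_natCast]
  exact Real.rpow_le_rpow_of_exponent_le (by norm_num) (sum_anisoExp_le hσ n)

end

/-! ### Piecewise polynomials and the marking of large values -/

instance : IsProbabilityMeasure (cubeMeasure d) :=
  ⟨by rw [cubeMeasure, Measure.restrict_apply_univ, volume_unitCube]⟩

lemma aestronglyMeasurable_of_mem_piecewisePoly {r : Fin d → ℕ} {j : Fin d → ℕ}
    {t : (Fin d → ℝ) → ℝ} (ht : t ∈ piecewisePoly r (dyadicBoxes j)) :
    AEStronglyMeasurable t (cubeMeasure d) := by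
  rw [cubeMeasure, ← biUnion_grid j]
  have : ⋃ K ∈ grid j, K = ⋃ K : grid j, K.1 := by
    rw [← Set.iUnion_subtype (· ∈ grid j) fun K => K.1]
  rw [this, aestronglyMeasurable_iUnion_iff]
  rintro ⟨K, hK⟩
  obtain ⟨P, -, hP⟩ := ht K (mem_grid.1 hK)
  refine (MvPolynomial.continuous_eval P).aestronglyMeasurable.congr ?_
  exact (ae_restrict_of_forall_mem (measurableSet_of_mem_dyadicBoxes (mem_grid.1 hK))
    fun x hx => (hP x hx).symm)

lemma piecewisePoly_sub {r : Fin d → ℕ} {𝒦 : Set (Set (Fin d → ℝ))} {t t' : (Fin d → ℝ) → ℝ}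
    (ht : t ∈ piecewisePoly r 𝒦) (ht' : t' ∈ piecewisePoly r 𝒦) : t - t' ∈ piecewisePoly r 𝒦 := by
  intro K hK
  obtain ⟨P, hP, h⟩ := ht K hK
  obtain ⟨P', hP', h'⟩ := ht' K hK
  refine ⟨P - P', fun l => (MvPolynomial.degreeOf_sub_le l P P').trans (max_le (hP l) (hP' l)),
    fun x hx => ?_⟩
  rw [Pi.sub_apply, h x hx, h' x hx, map_sub]

lemma piecewisePoly_add {r : Fin d → ℕ} {𝒦 : Set (Set (Fin d → ℝ))} {t t' : (Fin d → ℝ) → ℝ}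
    (ht : t ∈ piecewisePoly r 𝒦) (ht' : t' ∈ piecewisePoly r 𝒦) : t + t' ∈ piecewisePoly r 𝒦 := by
  intro K hK
  obtain ⟨P, hP, h⟩ := ht K hK
  obtain ⟨P', hP', h'⟩ := ht' K hK
  refine ⟨P + P', fun l => (MvPolynomial.degreeOf_add_le l P P').trans (max_le (hP l) (hP' l)),
    fun x hx => ?_⟩
  rw [Pi.add_apply, h x hx, h' x hx, map_add]

lemma piecewisePoly_sum {ι : Type*} {r : Fin d → ℕ} {𝒦 : Set (Set (Fin d → ℝ))} {S : Finset ι}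
    {t : ι → (Fin d → ℝ) → ℝ} (ht : ∀ i ∈ S, t i ∈ piecewisePoly r 𝒦) :
    ∑ i ∈ S, t i ∈ piecewisePoly r 𝒦 :=
  Finset.sum_induction t (· ∈ piecewisePoly r 𝒦) (fun _ _ => piecewisePoly_add)
    (fun _ _ => ⟨0, by simp, by simp⟩) ht

/-- Each `K` lies in one marked box, where `u` is a single polynomial, or misses them all, where the
indicator vanishes. -/
lemma piecewisePoly_indicator {r : Fin d → ℕ} {𝒦 : Set (Set (Fin d → ℝ))}
    {Λ : Finset (Set (Fin d → ℝ))} {u : (Fin d → ℝ) → ℝ}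
    (hu : u ∈ piecewisePoly r (Λ : Set (Set (Fin d → ℝ))))
    (h : ∀ M ∈ Λ, ∀ K ∈ 𝒦, K ⊆ M ∨ Disjoint K M) :
    (⋃ M ∈ Λ, M).indicator u ∈ piecewisePoly r 𝒦 := by
  intro K hK
  by_cases hM : ∃ M ∈ Λ, K ⊆ M
  · obtain ⟨M, hM, hKM⟩ := hM
    obtain ⟨P, hP, hPu⟩ := hu M hM
    refine ⟨P, hP, fun x hx => ?_⟩
    rw [Set.indicator_of_mem (Set.mem_iUnion₂.2 ⟨M, hM, hKM hx⟩), hPu x (hKM hx)]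
  · push Not at hM
    refine ⟨0, by simp, fun x hx => ?_⟩
    rw [Set.indicator_of_notMem, map_zero]
    intro hx'
    obtain ⟨M, hMΛ, hxM⟩ := Set.mem_iUnion₂.1 hx'
    exact Set.disjoint_left.1 ((h M hMΛ K hK).resolve_left (hM M hMΛ)) hx hxM

/-- Interpolation between `L_p` and `L_∞`: for finite `q`, integrate `|f|^q ≤ B^(q-p) |f|^p`. Values
`p < 1` are allowed. -/
lemma eLpNorm_le_of_bound_of_lt {α : Type*} [MeasurableSpace α] {μ : Measure α} {f : α → ℝ}
    {p : ℝ} (hp : 0 < p) {q : ℝ≥0∞} (hpq : ENNReal.ofReal p < q) {B : ℝ≥0∞} (hB : B ≠ ∞)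
    (hf : ∀ᵐ x ∂μ, ‖f x‖ₑ ≤ B) :
    eLpNorm f q μ ≤ B ^ (1 - p * (q⁻¹).toReal) *
      eLpNorm f (ENNReal.ofReal p) μ ^ (p * (q⁻¹).toReal) := by
  by_cases hq : q = ∞
  · subst hq
    simpa [eLpNormEssSup_eq_essSup_enorm] using essSup_le_of_ae_le B hf
  · have hq0 : q ≠ 0 := (bot_le.trans_lt hpq).ne'
    have hq' : 0 < q.toReal := ENNReal.toReal_pos hq0 hq
    have hpq' : p < q.toReal := by
      rwa [ENNReal.ofReal_lt_iff_lt_toReal hp.le hq] at hpq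
    rw [eLpNorm_eq_lintegral_rpow_enorm_toReal hq0 hq,
      eLpNorm_eq_lintegral_rpow_enorm_toReal (by simpa using hp) ENNReal.ofReal_ne_top,
      ENNReal.toReal_ofReal hp.le, ENNReal.toReal_inv]
    have h1 : ∫⁻ x, ‖f x‖ₑ ^ q.toReal ∂μ ≤
        B ^ (q.toReal - p) * ∫⁻ x, ‖f x‖ₑ ^ p ∂μ := by
      rw [← lintegral_const_mul' _ _ (ENNReal.rpow_ne_top_of_nonneg (by linarith) hB)]
      refine lintegral_mono_ae ?_
      filter_upwards [hf] with x hx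
      calc ‖f x‖ₑ ^ q.toReal = ‖f x‖ₑ ^ (q.toReal - p) * ‖f x‖ₑ ^ p := by
            rw [← ENNReal.rpow_add_of_nonneg _ _ (by linarith) hp.le, sub_add_cancel]
        _ ≤ _ := by gcongr
    calc _ ≤ (B ^ (q.toReal - p) * ∫⁻ x, ‖f x‖ₑ ^ p ∂μ) ^ (1 / q.toReal) := by gcongr
      _ = _ := by
        rw [ENNReal.mul_rpow_of_nonneg _ _ (by positivity), ← ENNReal.rpow_mul,
          ← ENNReal.rpow_mul]
        congr 2 <;> field_simp

lemma lintegral_cube_eq_sum (j : Fin d → ℕ) (f : (Fin d → ℝ) → ℝ≥0∞) :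
    ∫⁻ x, f x ∂(cubeMeasure d) = ∑ K ∈ grid j, ∫⁻ x in K, f x := by
  rw [cubeMeasure, ← biUnion_grid j]
  exact lintegral_biUnion_finset (pairwiseDisjoint_subBoxes _ _)
    (fun K hK => measurableSet_of_mem_dyadicBoxes (mem_grid.1 hK)) f

open Classical in
/-- A piecewise polynomial function becomes small in `L_q` after it has been set to zero on at
most `M` boxes. -/
lemma exists_marking (r : Fin d → ℕ) {p : ℝ} (hp : 0 < p) {q : ℝ≥0∞}
    (hpq : ENNReal.ofReal p < q) :
    ∃ c : ℝ, 0 < c ∧ ∀ (j : Fin d → ℕ) (u : (Fin d → ℝ) → ℝ) (A M : ℝ),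
      u ∈ piecewisePoly r (dyadicBoxes j) → 0 < A → 0 < M →
      cubeNorm (ENNReal.ofReal p) u ≤ ENNReal.ofReal A →
      ∃ Λ ⊆ grid j, (Λ.card : ℝ) ≤ M ∧
        cubeNorm q ((⋃ K ∈ Λ, K)ᶜ.indicator u) ≤
          ENNReal.ofReal (c * A * ((grid j).card / M) ^ (1 / p - (q⁻¹).toReal)) := by
  obtain ⟨C, hC, hCb⟩ := exists_dyadicBox_sup_bound r hp
  set C₀ : ℝ := C.toReal + 1 with hC₀
  have hC₀pos : 0 < C₀ := by positivity
  have hCC₀ : C ≤ ENNReal.ofReal C₀ := by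
    rw [← ENNReal.ofReal_toReal hC]; exact ENNReal.ofReal_le_ofReal (by linarith)
  have hθ0 : 0 ≤ (q⁻¹).toReal := ENNReal.toReal_nonneg
  have hθ1 : p * (q⁻¹).toReal ≤ 1 := by
    by_cases hq : q = ∞
    · simp [hq]
    · rw [ENNReal.toReal_inv, ← div_eq_mul_inv]
      rw [ENNReal.ofReal_lt_iff_lt_toReal hp.le hq] at hpq
      exact (div_le_one (hp.trans hpq)).2 hpq.le
  refine ⟨C₀ ^ (1 / p - (q⁻¹).toReal), by positivity, fun j u A M hu hA hM hAu => ?_⟩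
  set N : ℝ := ((grid j).card : ℝ) with hN
  have hNpos : 0 < N := by rw [hN, card_grid]; positivity
  -- The threshold is tuned to the budget: by the sup bound, a box where `u` exceeds `B` somewhere
  -- carries at least `A^p / M` of the integral of `|u|^p`, so at most `M` boxes do. Interpolating
  -- between `B` and `A` then yields the exponent `1/p - 1/q`.
  set B : ℝ := (C₀ * (N / M)) ^ (1 / p) * A with hB
  have hBpos : 0 < B := by positivity
  have hBp : B ^ p = C₀ * (N / M) * A ^ p := by
    rw [hB, Real.mul_rpow (by positivity) hA.le, ← Real.rpow_mul (by positivity),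
      one_div_mul_cancel hp.ne', Real.rpow_one]
  set Λ := (grid j).filter fun K => ¬ ∀ x ∈ K, ‖u x‖ₑ ≤ ENNReal.ofReal B with hΛ
  have hint : ∫⁻ x, ‖u x‖ₑ ^ p ∂(cubeMeasure d) ≤ ENNReal.ofReal (A ^ p) := by
    rw [cubeNorm, eLpNorm_eq_lintegral_rpow_enorm_toReal (by simpa using hp)
      ENNReal.ofReal_ne_top, ENNReal.toReal_ofReal hp.le, one_div,
      ENNReal.rpow_inv_le_iff hp, ENNReal.ofReal_rpow_of_pos hA] at hAu
    exact hAu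
  have hvol : ∀ K ∈ grid j, volume K = ENNReal.ofReal N⁻¹ := by
    intro K hK
    rw [volume_of_mem_dyadicBoxes (mem_grid.1 hK), ENNReal.ofReal_inv_of_pos hNpos, hN, card_grid,
      ENNReal.ofReal_natCast, ← ENNReal.inv_pow]
    push_cast
    rfl
  have hmark : ∀ K ∈ Λ, ENNReal.ofReal (A ^ p / M) ≤ ∫⁻ x in K, ‖u x‖ₑ ^ p := by
    intro K hK
    rw [hΛ, Finset.mem_filter] at hK
    obtain ⟨hKg, hKB⟩ := hK
    push Not at hKB
    obtain ⟨x, hxK, hx⟩ := hKB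
    obtain ⟨P, hP, hPu⟩ := hu K (mem_grid.1 hKg)
    have hKv := hvol K hKg
    obtain ⟨k, hk, rfl⟩ := mem_grid.1 hKg
    have h1 := hCb P hP j k x hxK
    rw [← hPu x hxK, hKv, setLIntegral_congr_fun (g := fun y => ‖u y‖ₑ ^ p)
      (measurableSet_dyadicBox j k) fun y hy => by simp only [hPu y hy]] at h1
    have h2 : ENNReal.ofReal C₀ * ENNReal.ofReal (A ^ p / M) ≤
        ENNReal.ofReal C₀ * ∫⁻ y in dyadicBox j k, ‖u y‖ₑ ^ p := by
      calc _ = ENNReal.ofReal B ^ p * ENNReal.ofReal N⁻¹ := by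
            rw [ENNReal.ofReal_rpow_of_pos hBpos, hBp, ← ENNReal.ofReal_mul (by positivity),
              ← ENNReal.ofReal_mul (by positivity)]
            congr 1
            field_simp
        _ ≤ ‖u x‖ₑ ^ p * ENNReal.ofReal N⁻¹ := by gcongr
        _ ≤ _ := h1
        _ ≤ _ := by gcongr
    exact (ENNReal.mul_le_mul_iff_right (by simpa using hC₀pos) ENNReal.ofReal_ne_top).1 h2
  refine ⟨Λ, Finset.filter_subset _ _, ?_, ?_⟩
  · have h1 : (Λ.card : ℝ≥0∞) * ENNReal.ofReal (A ^ p / M) ≤ ENNReal.ofReal (A ^ p) := by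
      rw [← nsmul_eq_mul, ← Finset.sum_const]
      refine (Finset.sum_le_sum hmark).trans (le_trans ?_ hint)
      rw [lintegral_cube_eq_sum j]
      exact Finset.sum_le_sum_of_subset (Finset.filter_subset _ _)
    rw [← ENNReal.ofReal_natCast, ← ENNReal.ofReal_mul (by positivity),
      ENNReal.ofReal_le_ofReal_iff (by positivity), ← mul_div_assoc, div_le_iff₀ hM,
      mul_comm] at h1
    exact le_of_mul_le_mul_left h1 (by positivity)
  · set v := (⋃ K ∈ Λ, K)ᶜ.indicator u with hv
    have hvB : ∀ᵐ x ∂(cubeMeasure d), ‖v x‖ₑ ≤ ENNReal.ofReal B := by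
      refine ae_restrict_of_forall_mem measurableSet_Icc fun x hx => ?_
      by_cases hxΛ : x ∈ ⋃ K ∈ Λ, K
      · rw [hv, Set.indicator_of_notMem (by simpa using hxΛ)]
        simp
      · rw [hv, Set.indicator_of_mem hxΛ]
        obtain ⟨K, hK, hxK⟩ := exists_dyadicBox_mem j hx
        by_contra hcon
        refine hxΛ (Set.mem_iUnion₂.2 ⟨K, Finset.mem_filter.2 ⟨mem_grid.2 hK, fun h => ?_⟩, hxK⟩)
        exact hcon (h x hxK)
    have hvA : cubeNorm (ENNReal.ofReal p) v ≤ ENNReal.ofReal A :=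
      (eLpNorm_mono_enorm fun x => by
        rw [hv, enorm_indicator_eq_indicator_enorm]
        exact Set.indicator_le_self _ (fun y => ‖u y‖ₑ) x).trans hAu
    refine (eLpNorm_le_of_bound_of_lt hp hpq ENNReal.ofReal_ne_top hvB).trans ?_
    calc _ ≤ ENNReal.ofReal B ^ (1 - p * (q⁻¹).toReal) *
          ENNReal.ofReal A ^ (p * (q⁻¹).toReal) := by gcongr; exact hvA
      _ = _ := by
        rw [ENNReal.ofReal_rpow_of_pos hBpos, ENNReal.ofReal_rpow_of_pos hA,
          ← ENNReal.ofReal_mul (by positivity), hB,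
          Real.mul_rpow (by positivity) hA.le, ← Real.rpow_mul (by positivity), mul_assoc,
          ← Real.rpow_add hA, sub_add_cancel, Real.rpow_one,
          show 1 / p * (1 - p * (q⁻¹).toReal) = 1 / p - (q⁻¹).toReal by field_simp,
          Real.mul_rpow hC₀pos.le (by positivity)]
        congr 1
        ring

/-! ### Telescoping series and near-best approximations -/

/-- The function `s` is not assumed to lie in `L_q`. Convergence in `L_p` gives an almost everywhere
convergent subsequence, and Fatou's lemma carries the bound on partial sums to the limit. -/
lemma eLpNorm_sub_le_tsum {α : Type*} [MeasurableSpace α] {μ : Measure α} {s : α → ℝ}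
    {t : ℕ → α → ℝ} {p q : ℝ≥0∞} (hp : p ≠ 0) (hq : 1 ≤ q) (hs : AEStronglyMeasurable s μ)
    (ht : ∀ n, AEStronglyMeasurable (t n) μ)
    (hlim : Filter.Tendsto (fun n => eLpNorm (s - t n) p μ) Filter.atTop (nhds 0)) (J : ℕ) :
    eLpNorm (s - t J) q μ ≤ ∑' i, eLpNorm (t (J + i + 1) - t (J + i)) q μ := by
  have hpart : ∀ k, eLpNorm (t (J + k) - t J) q μ ≤
      ∑' i, eLpNorm (t (J + i + 1) - t (J + i)) q μ := by
    intro k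
    refine le_trans ?_ (ENNReal.sum_le_tsum (Finset.range k))
    have : t (J + k) - t J = ∑ i ∈ Finset.range k, (t (J + i + 1) - t (J + i)) :=
      (Finset.sum_range_sub (fun i => t (J + i)) k).symm
    rw [this]
    exact eLpNorm_sum_le (fun i _ => (ht _).sub (ht _)) hq
  have hlim' : Filter.Tendsto (fun n => eLpNorm (t (J + n) - s) p μ) Filter.atTop (nhds 0) := by
    simp only [eLpNorm_sub_comm (t _) s]
    exact hlim.comp (Filter.tendsto_add_atTop_nat J |>.congr fun n => add_comm n J)
  obtain ⟨ns, -, hns⟩ := (tendstoInMeasure_of_tendsto_eLpNorm hp (fun n => ht (J + n)) hs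
    hlim').exists_seq_tendsto_ae
  refine (Lp.eLpNorm_lim_le_liminf_eLpNorm (f := fun i => t (J + ns i) - t J)
    (fun i => (ht _).sub (ht _)) (s - t J) ?_).trans ?_
  · filter_upwards [hns] with x hx
    exact hx.sub_const _
  · exact Filter.liminf_le_of_le (by isBoundedDefault) fun b hb => by
      obtain ⟨i, hi⟩ := hb.exists
      exact hi.trans (hpart _)

lemma level_error_le_of_mem_smoothClass {r : Fin d → ℕ} {σ : Fin d → ℝ} {p : ℝ} {p' : ℝ≥0∞}
    (hp' : 0 < p') {R : ℝ} {s : (Fin d → ℝ) → ℝ} (hs : s ∈ smoothClass r σ p p' R) (k : ℕ) :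
    ENNReal.ofReal ((2 : ℝ) ^ ((k : ℝ) * minSmooth σ)) * approxError r σ p k s ≤
      ENNReal.ofReal R := by
  obtain ⟨-, hs⟩ := hs
  refine le_trans ?_ hs
  unfold smoothSeminorm
  split_ifs with h
  · exact le_iSup (fun k : ℕ =>
      ENNReal.ofReal ((2 : ℝ) ^ ((k : ℝ) * minSmooth σ)) * approxError r σ p k s) k
  · have hpos : 0 < p'.toReal := ENNReal.toReal_pos hp'.ne' h
    rw [one_div, ENNReal.le_rpow_inv_iff hpos]
    exact ENNReal.le_tsum k

/-- The factor `2` leaves strict room above the infimum, so no minimiser is required. -/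
lemma exists_near_best {r : Fin d → ℕ} {σ : Fin d → ℝ} {p : ℝ} {R : ℝ} (hR : 0 < R)
    {s : (Fin d → ℝ) → ℝ} {k : ℕ}
    (h : ENNReal.ofReal ((2 : ℝ) ^ ((k : ℝ) * minSmooth σ)) * approxError r σ p k s ≤
      ENNReal.ofReal R) :
    ∃ t ∈ piecewisePoly r (dyadicBoxes (anisoExp σ k)), cubeNorm (ENNReal.ofReal p) (s - t) ≤
      ENNReal.ofReal (2 * R * (2 : ℝ) ^ (-((k : ℝ) * minSmooth σ))) := by
  have hx : (0 : ℝ) < (2 : ℝ) ^ ((k : ℝ) * minSmooth σ) := by positivity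
  have h1 : approxError r σ p k s ≤
      ENNReal.ofReal (R * (2 : ℝ) ^ (-((k : ℝ) * minSmooth σ))) := by
    rw [Real.rpow_neg (by norm_num), ← div_eq_mul_inv, ENNReal.ofReal_div_of_pos hx,
      ENNReal.le_div_iff_mul_le (by simp [hx]) (by simp), mul_comm]
    exact h
  have h2 : approxError r σ p k s <
      ENNReal.ofReal (2 * R * (2 : ℝ) ^ (-((k : ℝ) * minSmooth σ))) := by
    refine h1.trans_lt ((ENNReal.ofReal_lt_ofReal_iff (by positivity)).2 ?_)
    have : 0 < R * (2 : ℝ) ^ (-((k : ℝ) * minSmooth σ)) := by positivity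
    linarith
  rw [approxError] at h2
  obtain ⟨t, ht⟩ := iInf_lt_iff.1 h2
  obtain ⟨htm, ht⟩ := iInf_lt_iff.1 ht
  exact ⟨t, htm, ht.le⟩

lemma sum_Ioc_sub_le_tsum {f : ℕ → ℝ} (hf : ∀ n, 0 ≤ f n) (hs : Summable f) (k J : ℕ) :
    ∑ n ∈ Finset.Ioc k J, f (n - k) ≤ ∑' n, f n := by
  have h : Set.InjOn (fun n => n - k) (Finset.Ioc k J : Set ℕ) := by
    intro a ha b hb hab
    simp only [Finset.coe_Ioc, Set.mem_Ioc] at ha hb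
    simp only at hab
    omega
  rw [← Finset.sum_image (g := fun n => n - k) (f := f) h]
  exact hs.sum_le_tsum _ fun n _ => hf n

lemma sum_Ioc_telescope (t : ℕ → (Fin d → ℝ) → ℝ) {k J : ℕ} (hk : k ≤ J) :
    ∑ n ∈ Finset.Ioc k J, (t n - t (n - 1)) = t J - t k := by
  induction J, hk using Nat.le_induction with
  | base => simp
  | succ J hk ih =>
    rw [← Finset.insert_Ioc_right_eq_Ioc_add_one hk, Finset.sum_insert (by simp), ih]
    simp

/-! ### The adaptive error bound -/

/-- The error bound reached on partitions into `O(2^{k β})` boxes of level at most `J`. -/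
def AdaptiveBound (r : Fin d → ℕ) (σ : Fin d → ℝ) (p : ℝ) (q : ℝ≥0∞) (c C : ℝ) : Prop :=
  ∀ (s : (Fin d → ℝ) → ℝ) (R : ℝ), 0 < R → AEStronglyMeasurable s (cubeMeasure d) →
    (∀ n : ℕ, ENNReal.ofReal ((2 : ℝ) ^ ((n : ℝ) * minSmooth σ)) * approxError r σ p n s ≤
      ENNReal.ofReal R) →
    ∀ k J : ℕ, k ≤ J → ∃ m : Finset (Set (Fin d → ℝ)), m ∈ dyadicPartitions d J m.card ∧
      (m.card : ℝ) ≤ c * (2 : ℝ) ^ ((k : ℝ) * growthRate σ) ∧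
      ∃ t ∈ piecewisePoly r (m : Set (Set (Fin d → ℝ))), cubeNorm q (s - t) ≤
        ENNReal.ofReal (C * R * ((2 : ℝ) ^ (-((J : ℝ) *
          (minSmooth σ - growthRate σ * expGap p q))) + (2 : ℝ) ^ (-((k : ℝ) * minSmooth σ))))

lemma expGap_of_lt {p : ℝ} (hp : 0 < p) {q : ℝ≥0∞} (hpq : ENNReal.ofReal p < q) :
    expGap p q = 1 / p - (q⁻¹).toReal ∧ 0 < expGap p q := by
  have h : (q⁻¹).toReal < 1 / p := by
    by_cases hq : q = ∞
    · simp [hq, hp]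
    · rw [ENNReal.ofReal_lt_iff_lt_toReal hp.le hq] at hpq
      rw [ENNReal.toReal_inv, one_div]
      exact inv_strictAnti₀ hp hpq
  have h' : expGap p q = 1 / p - (q⁻¹).toReal := max_eq_left (sub_pos.2 h).le
  exact ⟨h', h' ▸ sub_pos.2 h⟩

/-- No adaptivity is needed here: on a probability space the `L_q` norm is at most the `L_p` norm,
and the grid of level `k` serves as the partition. -/
lemma adaptiveBound_of_le {r : Fin d → ℕ} {σ : Fin d → ℝ} (hσ : ∀ l, 0 < σ l)
    {p : ℝ} {q : ℝ≥0∞} (hqp : q ≤ ENNReal.ofReal p) : AdaptiveBound r σ p q 1 2 := by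
  intro s R hR hs herr k J hk
  obtain ⟨t, ht, hst⟩ := exists_near_best hR (herr k)
  refine ⟨grid (anisoExp σ k), ⟨rfl, fun K hK => ⟨_, fun l => (anisoExp_le hσ k l).trans hk,
    mem_grid.1 hK⟩, pairwiseDisjoint_subBoxes _ _, biUnion_grid _⟩, ?_, t, ?_, ?_⟩
  · rw [one_mul]
    exact card_grid_anisoExp_le hσ k
  · rwa [coe_grid]
  · refine (eLpNorm_le_eLpNorm_of_exponent_le hqp
      (hs.sub (aestronglyMeasurable_of_mem_piecewisePoly ht))).trans (hst.trans ?_)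
    refine ENNReal.ofReal_le_ofReal (mul_le_mul_of_nonneg_left ?_ (by positivity))
    exact le_add_of_nonneg_left (by positivity)

/-- The increments of near-best approximations. -/
lemma exists_increment_bound (r : Fin d → ℕ) {σ : Fin d → ℝ} (hσ : ∀ l, 0 < σ l) (p : ℝ) :
    ∃ a : ℝ, 0 < a ∧ ∀ (s : (Fin d → ℝ) → ℝ) (R : ℝ), 0 < R →
      AEStronglyMeasurable s (cubeMeasure d) → ∀ t : ℕ → (Fin d → ℝ) → ℝ,
      (∀ n, t n ∈ piecewisePoly r (dyadicBoxes (anisoExp σ n))) →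
      (∀ n : ℕ, cubeNorm (ENNReal.ofReal p) (s - t n) ≤
        ENNReal.ofReal (2 * R * (2 : ℝ) ^ (-((n : ℝ) * minSmooth σ)))) →
      ∀ n, 1 ≤ n → t n - t (n - 1) ∈ piecewisePoly r (dyadicBoxes (anisoExp σ n)) ∧
        cubeNorm (ENNReal.ofReal p) (t n - t (n - 1)) ≤
          ENNReal.ofReal (a * R * (2 : ℝ) ^ (-((n : ℝ) * minSmooth σ))) := by
  -- The constant of the quasi-triangle inequality, needed when `p < 1`. Adding one to it ensures
  -- positivity, and the factor `2^S + 1` collects the errors of levels `n - 1` and `n`.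
  set L := (ENNReal.LpAddConst (ENNReal.ofReal p)).toReal with hL
  have hLnn : 0 ≤ L := ENNReal.toReal_nonneg
  refine ⟨(L + 1) * (2 * ((2 : ℝ) ^ minSmooth σ + 1)), by positivity,
    fun s R hR hs t ht hst n hn => ⟨?_, ?_⟩⟩
  · refine piecewisePoly_sub (ht n) (piecewisePoly_subset_of_refines r (fun K hK => ?_)
      (ht (n - 1)))
    exact exists_parent (monotone_anisoExp hσ (Nat.sub_le n 1)) hK
  · have hm := fun n => aestronglyMeasurable_of_mem_piecewisePoly (ht n)
    have h1 : t n - t (n - 1) = (s - t (n - 1)) - (s - t n) := by abel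
    have hLt := (ENNReal.LpAddConst_lt_top (ENNReal.ofReal p)).ne
    rw [h1]
    refine (eLpNorm_sub_le' (hs.sub (hm _)) (hs.sub (hm _)) _).trans ?_
    have h2 : ENNReal.LpAddConst (ENNReal.ofReal p) ≤ ENNReal.ofReal (L + 1) := by
      rw [← ENNReal.ofReal_toReal hLt]
      exact ENNReal.ofReal_le_ofReal (by linarith)
    calc _ ≤ ENNReal.ofReal (L + 1) *
          (ENNReal.ofReal (2 * R * (2 : ℝ) ^ (-(((n - 1 : ℕ) : ℝ) * minSmooth σ))) +
            ENNReal.ofReal (2 * R * (2 : ℝ) ^ (-((n : ℝ) * minSmooth σ)))) := by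
          gcongr
          · exact hst _
          · exact hst _
      _ = _ := by
        rw [← ENNReal.ofReal_add (by positivity) (by positivity),
          ← ENNReal.ofReal_mul (by positivity)]
        congr 1
        have : -(((n - 1 : ℕ) : ℝ) * minSmooth σ) =
            minSmooth σ + -((n : ℝ) * minSmooth σ) := by
          push_cast [Nat.cast_sub hn]; ring
        rw [this, Real.rpow_add (by norm_num)]
        ring

lemma tail_error_le {b R δ : ℝ} (hb : 0 < b) (hR : 0 < R) (hδ : 0 < δ) (J : ℕ) :
    ∑' i : ℕ, ENNReal.ofReal (b * R * (2 : ℝ) ^ (-(((J + i + 1 : ℕ) : ℝ) * δ))) ≤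
      ENNReal.ofReal (b * (1 - (2 : ℝ) ^ (-δ))⁻¹ * R * (2 : ℝ) ^ (-((J : ℝ) * δ))) := by
  have hρ : (2 : ℝ) ^ (-δ) < 1 := Real.rpow_lt_one_of_one_lt_of_neg (by norm_num) (by linarith)
  have hρ0 : (0 : ℝ) ≤ (2 : ℝ) ^ (-δ) := by positivity
  have hle : ∀ i : ℕ, b * R * (2 : ℝ) ^ (-(((J + i + 1 : ℕ) : ℝ) * δ)) ≤
      b * R * (2 : ℝ) ^ (-((J : ℝ) * δ)) * ((2 : ℝ) ^ (-δ)) ^ i := by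
    intro i
    rw [mul_assoc _ _ (((2 : ℝ) ^ (-δ)) ^ i), ← Real.rpow_natCast, ← Real.rpow_mul (by norm_num),
      ← Real.rpow_add (by norm_num)]
    refine mul_le_mul_of_nonneg_left (Real.rpow_le_rpow_of_exponent_le (by norm_num) ?_)
      (by positivity)
    push_cast
    nlinarith
  refine (ENNReal.tsum_le_tsum fun i => ENNReal.ofReal_le_ofReal (hle i)).trans ?_
  rw [← ENNReal.ofReal_tsum_of_nonneg (fun i => by positivity)
    ((summable_geometric_of_lt_one hρ0 hρ).mul_left _), tsum_mul_left,
    tsum_geometric_of_lt_one hρ0 hρ]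
  refine ENNReal.ofReal_le_ofReal (le_of_eq ?_)
  ring

/-- The number of boxes that may be marked `i` levels below the starting level `k`. -/
lemma marking_budget {c a R S β γ ε N : ℝ} (hc : 0 < c) (ha : 0 < a) (hR : 0 < R) (hγ : 0 < γ)
    (k i : ℕ) (hN0 : 0 ≤ N) (hN : N ≤ (2 : ℝ) ^ (((k + i : ℕ) : ℝ) * β)) :
    c * (a * R * (2 : ℝ) ^ (-(((k + i : ℕ) : ℝ) * S))) *
        (N / ((2 : ℝ) ^ ((k : ℝ) * β) * ((2 : ℝ) ^ (-ε)) ^ i)) ^ γ ≤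
      c * a * R * (2 : ℝ) ^ (-((k : ℝ) * S)) * ((2 : ℝ) ^ (-(S - β * γ - ε * γ))) ^ i := by
  have h1 : N / ((2 : ℝ) ^ ((k : ℝ) * β) * ((2 : ℝ) ^ (-ε)) ^ i) ≤
      (2 : ℝ) ^ ((i : ℝ) * (β + ε)) := by
    rw [div_le_iff₀ (by positivity), ← Real.rpow_natCast, ← Real.rpow_mul (by norm_num),
      ← Real.rpow_add (by norm_num), ← Real.rpow_add (by norm_num)]
    refine hN.trans_eq ?_
    congr 1
    push_cast
    ring
  calc _ ≤ c * (a * R * (2 : ℝ) ^ (-(((k + i : ℕ) : ℝ) * S))) *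
        ((2 : ℝ) ^ ((i : ℝ) * (β + ε))) ^ γ := by gcongr
    _ = c * a * R * ((2 : ℝ) ^ (-(((k + i : ℕ) : ℝ) * S)) *
        ((2 : ℝ) ^ ((i : ℝ) * (β + ε))) ^ γ) := by ring
    _ = c * a * R * ((2 : ℝ) ^ (-((k : ℝ) * S)) *
        ((2 : ℝ) ^ (-(S - β * γ - ε * γ))) ^ i) := by
      congr 1
      rw [← Real.rpow_natCast, ← Real.rpow_mul (by norm_num), ← Real.rpow_mul (by norm_num),
        ← Real.rpow_add (by norm_num), ← Real.rpow_add (by norm_num)]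
      congr 1
      push_cast
      ring
    _ = _ := by ring

lemma exists_adaptiveBound_of_lt (r : Fin d → ℕ) {σ : Fin d → ℝ} (hσ : ∀ l, 0 < σ l)
    (hd : 1 ≤ d) {p : ℝ} (hp : 0 < p) {q : ℝ≥0∞} (hq : 1 ≤ q) (hpq : ENNReal.ofReal p < q)
    (hδ : 0 < minSmooth σ - growthRate σ * expGap p q) :
    ∃ c C : ℝ, 0 < c ∧ 0 < C ∧ AdaptiveBound r σ p q c C := by
  classical
  obtain ⟨hγeq, hγ⟩ := expGap_of_lt hp hpq
  obtain ⟨c, hc, hmarking⟩ := exists_marking r hp hpq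
  rw [← hγeq] at hmarking
  obtain ⟨a, ha, hincr⟩ := exists_increment_bound r hσ p
  have hS : 0 < minSmooth σ := minSmooth_pos hσ hd
  set S := minSmooth σ with hSdef
  set β := growthRate σ with hβ
  set γ := expGap p q with hγdef
  set δ := S - β * γ with hδdef
  -- The budgets must decay in `n - k` for the box count to be summable, but a decay rate `ε` costs
  -- `εγ` in the error. This choice spends half of the margin `δ` and leaves `δ / 2` for the error.
  set ε := δ / (2 * γ) with hε
  have hεγ : S - β * γ - ε * γ = δ / 2 := by rw [hε]; field_simp; ring
  have hε0 : 0 < ε := by positivity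
  set θ : ℝ := (2 : ℝ) ^ (-ε) with hθ
  have hθ0 : 0 < θ := by positivity
  have hθ1 : θ < 1 := Real.rpow_lt_one_of_one_lt_of_neg (by norm_num) (by linarith)
  set ρ : ℝ := (2 : ℝ) ^ (-(δ / 2)) with hρ
  have hρ0 : 0 < ρ := by positivity
  have hρ1 : ρ < 1 := Real.rpow_lt_one_of_one_lt_of_neg (by norm_num) (by linarith)
  have hρ' : (2 : ℝ) ^ (-δ) < 1 := Real.rpow_lt_one_of_one_lt_of_neg (by norm_num) (by linarith)
  have hsumθ : Summable fun i : ℕ => (i : ℝ) * θ ^ i := by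
    simpa using summable_pow_mul_geometric_of_norm_lt_one 1
      (r := θ) (by rwa [Real.norm_of_nonneg hθ0.le])
  have hsumθ0 : 0 ≤ ∑' i : ℕ, (i : ℝ) * θ ^ i := tsum_nonneg fun i => by positivity
  have hsumρ : Summable fun i : ℕ => ρ ^ i := summable_geometric_of_lt_one hρ0.le hρ1
  set b₁ : ℝ := c * a * (2 : ℝ) ^ γ * (1 - (2 : ℝ) ^ (-δ))⁻¹ with hb₁
  set b₂ : ℝ := c * a * (1 - ρ)⁻¹ with hb₂
  have hb₁0 : 0 < b₁ := by
    have := inv_pos.2 (sub_pos.2 hρ'); positivity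
  have hb₂0 : 0 < b₂ := by
    have := inv_pos.2 (sub_pos.2 hρ1); positivity
  refine ⟨1 + 2 ^ d * ∑' i : ℕ, (i : ℝ) * θ ^ i, max b₁ b₂, by positivity,
    lt_max_of_lt_left hb₁0, ?_⟩
  intro s R hR hs herr k J hkJ
  choose t ht hst using fun n => exists_near_best hR (herr n)
  have htm := fun n => aestronglyMeasurable_of_mem_piecewisePoly (ht n)
  have hu := hincr s R hR hs t ht hst
  have hAn : ∀ n : ℕ, 0 < a * R * (2 : ℝ) ^ (-((n : ℝ) * S)) := fun n => by positivity
  -- the part of the error above level `J`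
  have htail : cubeNorm q (s - t J) ≤
      ENNReal.ofReal (b₁ * R * (2 : ℝ) ^ (-((J : ℝ) * δ))) := by
    have hlim : Filter.Tendsto (fun n => eLpNorm (s - t n) (ENNReal.ofReal p) (cubeMeasure d))
        Filter.atTop (nhds 0) := by
      refine tendsto_of_tendsto_of_tendsto_of_le_of_le tendsto_const_nhds ?_
        (fun _ => zero_le) hst
      rw [← ENNReal.ofReal_zero]
      refine ENNReal.tendsto_ofReal ?_
      rw [← mul_zero (2 * R)]
      refine Filter.Tendsto.const_mul _ ?_
      have : (2 : ℝ) ^ (-S) < 1 := Real.rpow_lt_one_of_one_lt_of_neg (by norm_num) (by linarith)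
      refine (tendsto_pow_atTop_nhds_zero_of_lt_one (by positivity) this).congr fun n => ?_
      rw [← Real.rpow_natCast, ← Real.rpow_mul (by norm_num)]
      congr 1
      ring
    refine (eLpNorm_sub_le_tsum (by simpa using hp) hq hs htm hlim J).trans
      (le_trans (ENNReal.tsum_le_tsum fun i => ?_)
        (tail_error_le (b := c * a * (2 : ℝ) ^ γ) (by positivity) hR hδ J))
    obtain ⟨hu1, hu2⟩ := hu (J + i + 1) (by omega)
    rw [Nat.add_sub_cancel] at hu1 hu2
    -- A budget of `1/2` forbids marking any box. What remains is the inverse inequality bounding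
    -- the `L_q` norm by `N^γ` times the `L_p` bound, with `N` the number of boxes.
    obtain ⟨Λ, -, hΛ, hΛe⟩ := hmarking _ _ _ (1 / 2) hu1 (hAn _) (by norm_num) hu2
    have hΛ0 : Λ = ∅ := by
      rw [← Finset.card_eq_zero]
      have : (Λ.card : ℝ) < 1 := hΛ.trans_lt (by norm_num)
      exact_mod_cast Nat.lt_one_iff.1 (by exact_mod_cast this)
    subst hΛ0
    rw [show (⋃ K ∈ (∅ : Finset (Set (Fin d → ℝ))), K)ᶜ = Set.univ by simp,
      Set.indicator_univ] at hΛe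
    refine hΛe.trans (ENNReal.ofReal_le_ofReal ?_)
    calc _ ≤ c * (a * R * (2 : ℝ) ^ (-(((J + i + 1 : ℕ) : ℝ) * S))) *
          ((2 : ℝ) ^ (((J + i + 1 : ℕ) : ℝ) * β) / (1 / 2)) ^ γ := by
          gcongr
          exact card_grid_anisoExp_le hσ _
      _ = c * a * (2 : ℝ) ^ γ * R * ((2 : ℝ) ^ (-(((J + i + 1 : ℕ) : ℝ) * S)) *
          (2 : ℝ) ^ (((J + i + 1 : ℕ) : ℝ) * β * γ)) := by
          rw [one_div, div_inv_eq_mul, Real.mul_rpow (by positivity) (by norm_num),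
            ← Real.rpow_mul (by norm_num)]
          ring
      _ = _ := by
          rw [← Real.rpow_add (by norm_num)]
          congr 2
          rw [hδdef]
          ring
  -- the marked boxes of the levels between `k` and `J`
  have hlevel : ∀ n, ∃ Λ ⊆ grid (anisoExp σ n), (k < n →
      (Λ.card : ℝ) ≤ (2 : ℝ) ^ ((k : ℝ) * β) * θ ^ (n - k) ∧
      cubeNorm q ((⋃ K ∈ Λ, K)ᶜ.indicator (t n - t (n - 1))) ≤
        ENNReal.ofReal (c * a * R * (2 : ℝ) ^ (-((k : ℝ) * S)) * ρ ^ (n - k))) := by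
    intro n
    by_cases hkn : k < n
    · obtain ⟨hu1, hu2⟩ := hu n (by omega)
      obtain ⟨Λ, hΛg, hΛ, hΛe⟩ := hmarking _ _ _ ((2 : ℝ) ^ ((k : ℝ) * β) * θ ^ (n - k)) hu1
        (hAn _) (by positivity) hu2
      refine ⟨Λ, hΛg, fun _ => ⟨hΛ, hΛe.trans (ENNReal.ofReal_le_ofReal ?_)⟩⟩
      have hn := Nat.add_sub_cancel' hkn.le
      have := marking_budget (S := S) (β := β) (ε := ε) hc ha hR hγ k (n - k)
        (Nat.cast_nonneg _) (by rw [hn]; exact card_grid_anisoExp_le hσ n)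
      rwa [hn, hεγ] at this
    · exact ⟨∅, by simp, fun h => absurd h hkn⟩
  choose Λ hΛg hΛ using hlevel
  obtain ⟨m, hm, hmB, hmΛ, hmcard⟩ := exists_adapted_partition (monotone_anisoExp hσ)
    (anisoExp_succ_le hσ) (anisoExp_le hσ) hΛg hkJ
  refine ⟨m, hm, ?_, t k + ∑ n ∈ Finset.Ioc k J,
    (⋃ K ∈ Λ n, K).indicator (t n - t (n - 1)), ?_, ?_⟩
  · have h1 : (m.card : ℝ) ≤ (grid (anisoExp σ k)).card +
        2 ^ d * ∑ n ∈ Finset.Ioc k J, ((n - k : ℕ) : ℝ) * (Λ n).card := by exact_mod_cast hmcard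
    calc (m.card : ℝ) ≤ _ := h1
      _ ≤ (2 : ℝ) ^ ((k : ℝ) * β) + 2 ^ d * ∑ n ∈ Finset.Ioc k J,
          (2 : ℝ) ^ ((k : ℝ) * β) * (((n - k : ℕ) : ℝ) * θ ^ (n - k)) := by
        refine add_le_add (card_grid_anisoExp_le hσ k)
          (mul_le_mul_of_nonneg_left (Finset.sum_le_sum fun n hn => ?_) (by positivity))
        rw [mul_left_comm]
        exact mul_le_mul_of_nonneg_left (hΛ n (Finset.mem_Ioc.1 hn).1).1 (by positivity)
      _ ≤ (2 : ℝ) ^ ((k : ℝ) * β) + 2 ^ d * ((2 : ℝ) ^ ((k : ℝ) * β) *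
          ∑' i : ℕ, (i : ℝ) * θ ^ i) := by
        rw [← Finset.mul_sum]
        gcongr
        exact sum_Ioc_sub_le_tsum (f := fun i : ℕ => (i : ℝ) * θ ^ i)
          (fun i => by positivity) hsumθ k J
      _ = _ := by ring
  · refine piecewisePoly_add (piecewisePoly_subset_of_refines r (fun K hK => ?_) (ht k))
      (piecewisePoly_sum fun n hn => piecewisePoly_indicator
        (piecewisePoly_subset_of_refines r (fun M hM => ⟨M, mem_grid.1 (hΛg n hM), subset_rfl⟩)
          (hu n (by have := (Finset.mem_Ioc.1 hn).1; omega)).1)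
        fun M hM K hK => hmΛ n hn M hM K hK)
    obtain ⟨B, hB, hKB⟩ := hmB K hK
    exact ⟨B, mem_grid.1 hB, hKB⟩
  -- The marked parts cancel against the approximant, leaving the tail beyond `J` and the unmarked
  -- parts.
  · have hdecomp : s - (t k + ∑ n ∈ Finset.Ioc k J,
        (⋃ K ∈ Λ n, K).indicator (t n - t (n - 1))) =
        (s - t J) + ∑ n ∈ Finset.Ioc k J, (⋃ K ∈ Λ n, K)ᶜ.indicator (t n - t (n - 1)) := by
      have h1 := sum_Ioc_telescope t hkJ
      have h2 : ∑ n ∈ Finset.Ioc k J, (⋃ K ∈ Λ n, K)ᶜ.indicator (t n - t (n - 1)) +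
          ∑ n ∈ Finset.Ioc k J, (⋃ K ∈ Λ n, K).indicator (t n - t (n - 1)) = t J - t k := by
        rw [← h1, ← Finset.sum_add_distrib]
        exact Finset.sum_congr rfl fun n _ => Set.indicator_compl_add_self _ _
      rw [← eq_sub_iff_add_eq] at h2
      rw [h2]
      abel
    have hmeasΛ : ∀ n, MeasurableSet (⋃ K ∈ Λ n, K) := fun n =>
      Finset.measurableSet_biUnion _ fun K hK =>
        measurableSet_of_mem_dyadicBoxes (mem_grid.1 (hΛg n hK))
    have hmv : ∀ n ∈ Finset.Ioc k J, AEStronglyMeasurable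
        ((⋃ K ∈ Λ n, K)ᶜ.indicator (t n - t (n - 1))) (cubeMeasure d) :=
      fun n _ => ((htm n).sub (htm _)).indicator (hmeasΛ n).compl
    rw [hdecomp]
    refine (eLpNorm_add_le (hs.sub (htm J)) (Finset.aestronglyMeasurable_sum _ hmv) hq).trans ?_
    have hmid : eLpNorm (∑ n ∈ Finset.Ioc k J, (⋃ K ∈ Λ n, K)ᶜ.indicator (t n - t (n - 1))) q
        (cubeMeasure d) ≤ ENNReal.ofReal (b₂ * R * (2 : ℝ) ^ (-((k : ℝ) * S))) := by
      refine (eLpNorm_sum_le hmv hq).trans ((Finset.sum_le_sum fun n hn =>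
        (hΛ n (Finset.mem_Ioc.1 hn).1).2).trans ?_)
      rw [← ENNReal.ofReal_sum_of_nonneg fun n _ => by positivity]
      refine ENNReal.ofReal_le_ofReal ?_
      rw [← Finset.mul_sum]
      calc _ ≤ c * a * R * (2 : ℝ) ^ (-((k : ℝ) * S)) * ∑' i : ℕ, ρ ^ i := by
            gcongr
            exact sum_Ioc_sub_le_tsum (f := fun i : ℕ => ρ ^ i) (fun i => by positivity) hsumρ k J
        _ = _ := by
            rw [tsum_geometric_of_lt_one hρ0.le hρ1, hb₂]
            ring
    refine (add_le_add htail hmid).trans ?_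
    rw [← ENNReal.ofReal_add (by positivity) (by positivity)]
    refine ENNReal.ofReal_le_ofReal ?_
    rw [mul_add]
    gcongr
    · exact le_max_left _ _
    · exact le_max_right _ _

/-! ### From levels to the number of pieces -/

lemma growthRate_pos {σ : Fin d → ℝ} (hσ : ∀ l, 0 < σ l) (hd : 1 ≤ d) : 0 < growthRate σ := by
  have : Nonempty (Fin d) := ⟨⟨0, hd⟩⟩
  exact mul_pos (minSmooth_pos hσ hd)
    (Finset.sum_pos (fun l _ => one_div_pos.2 (hσ l)) Finset.univ_nonempty)

lemma harmMean_div_eq {σ : Fin d → ℝ} (hσ : ∀ l, 0 < σ l) (hd : 1 ≤ d) :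
    harmMean σ / d = minSmooth σ / growthRate σ := by
  have hS := minSmooth_pos hσ hd
  have hβ := growthRate_pos hσ hd
  rw [growthRate] at hβ ⊢
  have hsum : 0 < ∑ l, 1 / σ l := pos_of_mul_pos_right hβ hS.le
  have hd0 : (0 : ℝ) < d := by exact_mod_cast hd
  rw [harmMean]
  field_simp

lemma rate_exponent_eq {σ : Fin d → ℝ} (hσ : ∀ l, 0 < σ l) (hd : 1 ≤ d) (g x : ℝ) :
    x * d * (harmMean σ / d - g) * minSmooth σ / harmMean σ =
      x * (minSmooth σ - growthRate σ * g) := by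
  have hS := minSmooth_pos hσ hd
  have hβ := growthRate_pos hσ hd
  have hd0 : (0 : ℝ) < d := by exact_mod_cast hd
  have hH : harmMean σ = d * (minSmooth σ / growthRate σ) := by
    rw [← harmMean_div_eq hσ hd]; field_simp
  rw [hH]
  field_simp

/-- The level `k` is the largest one up to `J` whose guaranteed box count `c' 2^{kβ}` fits into `D`.
Either `k = J`, or level `k + 1` overshoots `D`, which bounds `2^{-kS}` by a multiple of `D^{-S/β}`.
-/
lemma exists_approx_of_adaptiveBound {r : Fin d → ℕ} {σ : Fin d → ℝ} (hσ : ∀ l, 0 < σ l)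
    (hd : 1 ≤ d) {p : ℝ} {q : ℝ≥0∞} {c C : ℝ} (hC : 0 < C)
    (h : AdaptiveBound r σ p q c C) :
    ∃ C' : ℝ, 0 < C' ∧ ∀ (s : (Fin d → ℝ) → ℝ) (R : ℝ), 0 < R →
      AEStronglyMeasurable s (cubeMeasure d) →
      (∀ n : ℕ, ENNReal.ofReal ((2 : ℝ) ^ ((n : ℝ) * minSmooth σ)) * approxError r σ p n s ≤
        ENNReal.ofReal R) →
      ∀ J D : ℕ, 1 ≤ D → D ≤ 2 ^ (J * d) → ∃ t ∈ nonlinSpace r J D, cubeNorm q (s - t) ≤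
        ENNReal.ofReal (C' * R * ((2 : ℝ) ^ (-((J : ℝ) *
          (minSmooth σ - growthRate σ * expGap p q))) +
            (D : ℝ) ^ (-(minSmooth σ / growthRate σ)))) := by
  have hS := minSmooth_pos hσ hd
  have hβ := growthRate_pos hσ hd
  have hg : 0 ≤ expGap p q := le_max_right _ _
  set S := minSmooth σ
  set β := growthRate σ
  set g := expGap p q
  set E := S / β with hE
  have hE0 : 0 < E := by positivity
  set c' := max c 1 with hc'
  have hc'1 : 1 ≤ c' := le_max_right _ _
  have hc'0 : 0 < c' := by linarith
  have h2S : (1 : ℝ) ≤ (2 : ℝ) ^ S := Real.one_le_rpow (by norm_num) hS.le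
  have hcE : (1 : ℝ) ≤ c' ^ E := Real.one_le_rpow hc'1 hE0.le
  have hK : 1 ≤ c' ^ E * (2 : ℝ) ^ S := one_le_mul_of_one_le_of_one_le hcE h2S
  -- The factor `c'^E` comes from solving `D ≤ c' 2^{xβ}` for `2^{-xS}`, and `2^S` from passing
  -- between levels `k` and `k + 1`.
  refine ⟨2 * C * (c' ^ E * (2 : ℝ) ^ S), by positivity, ?_⟩
  intro s R hR hs herr J D hD1 hDJ
  have hD0 : (0 : ℝ) < D := by exact_mod_cast hD1
  -- lower bound for the second term of the rate
  have hlow : ∀ x : ℝ, (D : ℝ) ≤ c' * (2 : ℝ) ^ (x * β) →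
      (2 : ℝ) ^ (-(x * S)) ≤ c' ^ E * (D : ℝ) ^ (-E) := by
    intro x hx
    have h1 : (D : ℝ) ^ E ≤ c' ^ E * (2 : ℝ) ^ (x * S) := by
      refine (Real.rpow_le_rpow hD0.le hx hE0.le).trans_eq ?_
      rw [Real.mul_rpow hc'0.le (by positivity), ← Real.rpow_mul (by norm_num), hE]
      congr 2
      field_simp
    rw [Real.rpow_neg (by norm_num), Real.rpow_neg hD0.le, ← div_eq_mul_inv,
      le_div_iff₀ (by positivity), inv_mul_le_iff₀ (by positivity), mul_comm]
    exact h1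
  suffices ∃ k J' : ℕ, k ≤ J' ∧ J' ≤ J ∧ (∀ m ∈ dyadicPartitions d J' m.card,
      (m.card : ℝ) ≤ c' * (2 : ℝ) ^ ((k : ℝ) * β) → m.card ≤ D) ∧
      (2 : ℝ) ^ (-((J' : ℝ) * (S - β * g))) + (2 : ℝ) ^ (-((k : ℝ) * S)) ≤
        2 * (c' ^ E * (2 : ℝ) ^ S) * ((2 : ℝ) ^ (-((J : ℝ) * (S - β * g))) +
          (D : ℝ) ^ (-E)) by
    obtain ⟨k, J', hkJ, hJ', hcard, hrate⟩ := this
    obtain ⟨m, hm, hmc, t, ht, hst⟩ := h s R hR hs herr k J' hkJ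
    refine ⟨t, piecewisePoly_subset_nonlinSpace r (mem_dyadicPartitions_of_le hJ' hm)
      (hcard m hm (hmc.trans ?_)) hDJ ht, hst.trans (ENNReal.ofReal_le_ofReal ?_)⟩
    · gcongr
      exact le_max_left _ _
    · calc _ ≤ C * R * (2 * (c' ^ E * (2 : ℝ) ^ S) *
            ((2 : ℝ) ^ (-((J : ℝ) * (S - β * g))) + (D : ℝ) ^ (-E))) := by gcongr
        _ = _ := by ring
  have hT : (0 : ℝ) < (2 : ℝ) ^ (-((J : ℝ) * (S - β * g))) := by positivity
  have hDE : (0 : ℝ) < (D : ℝ) ^ (-E) := by positivity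
  -- For `D` below `c'` not even level `0` is guaranteed to fit. With maximal level `0` the
  -- partition has at most one box, and the error is harmless because `D^{-E}` is bounded below.
  by_cases hDc : (D : ℝ) < c'
  · refine ⟨0, 0, le_rfl, Nat.zero_le _, fun m hm _ => ?_, ?_⟩
    · have := card_le_of_mem_dyadicPartitions hm
      rw [zero_mul, pow_zero] at this
      omega
    · have h1 := hlow 0 (by simpa using hDc.le)
      simp only [Nat.cast_zero, zero_mul, neg_zero, Real.rpow_zero] at h1 ⊢
      nlinarith [mul_pos (by positivity : 0 < c' ^ E * (2 : ℝ) ^ S) hT,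
        mul_le_mul_of_nonneg_left h2S (by positivity : 0 ≤ c' ^ E * (D : ℝ) ^ (-E))]
  · push Not at hDc
    classical
    set P : ℕ → Prop := fun k => c' * (2 : ℝ) ^ ((k : ℝ) * β) ≤ D with hP
    have hP0 : P 0 := by simpa [hP] using hDc
    set k := Nat.findGreatest P J with hk
    have hPk : P k := Nat.findGreatest_spec (Nat.zero_le J) hP0
    have hkJ : k ≤ J := Nat.findGreatest_le J
    refine ⟨k, J, hkJ, le_rfl, fun m _ hmc => ?_, ?_⟩
    · exact_mod_cast hmc.trans hPk
    -- If `k = J`, then `2^{-JS}` is absorbed by the first term of the rate, as `βγ ≥ 0`. Otherwise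
    -- maximality of `k` makes `k + 1` overshoot.
    · rcases hkJ.eq_or_lt with hkJ | hkJ
      · rw [hkJ]
        have h1 : (2 : ℝ) ^ (-((J : ℝ) * S)) ≤ (2 : ℝ) ^ (-((J : ℝ) * (S - β * g))) := by
          refine Real.rpow_le_rpow_of_exponent_le (by norm_num) (neg_le_neg ?_)
          gcongr
          have : 0 ≤ β * g := by positivity
          linarith
        nlinarith [mul_pos (by positivity : 0 < c' ^ E * (2 : ℝ) ^ S) hDE,
          mul_le_mul_of_nonneg_right hK hT.le]
      · have hnP : ¬ P (k + 1) := Nat.findGreatest_is_greatest (Nat.lt_succ_self k) hkJ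
        have h1 := hlow ((k + 1 : ℕ) : ℝ) (not_le.1 hnP).le
        have h2 : (2 : ℝ) ^ (-((k : ℝ) * S)) =
            (2 : ℝ) ^ S * (2 : ℝ) ^ (-(((k + 1 : ℕ) : ℝ) * S)) := by
          rw [← Real.rpow_add (by norm_num)]
          congr 1
          push_cast
          ring
        rw [h2]
        have h3 := mul_le_mul_of_nonneg_left h1 (by positivity : (0 : ℝ) ≤ (2 : ℝ) ^ S)
        nlinarith [mul_pos (by positivity : 0 < c' ^ E * (2 : ℝ) ^ S) hDE,
          mul_le_mul_of_nonneg_right hK hT.le]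

end AnisoDyadic

theorem mainTheorem9 (d : ℕ) (hd : 1 ≤ d) (r : Fin d → ℕ)
    (σ : Fin d → ℝ) (hσ : ∀ l, 0 < σ l ∧ σ l < (r l : ℝ) + 1)
    (p : ℝ) (hp : 0 < p) (q : ℝ≥0∞) (hq : 1 ≤ q)
    (hH : AnisoDyadic.expGap p q < AnisoDyadic.harmMean σ / (d : ℝ)) :
    ∃ C : ℝ, 0 < C ∧
      ∀ (J : ℕ) (R : ℝ) (p' : ℝ≥0∞), 0 < R → 0 < p' →
        (1 < p → ENNReal.ofReal p < q → p' ≤ ENNReal.ofReal p) →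
        ∀ D : ℕ, 1 ≤ D → D ≤ 2 ^ (J * d) →
          (⨆ s ∈ AnisoDyadic.smoothClass r σ p p' R,
            ⨅ t ∈ AnisoDyadic.nonlinSpace r J D, AnisoDyadic.cubeNorm q (s - t)) ≤
          ENNReal.ofReal (C * R *
            ((2 : ℝ) ^ (-((J : ℝ) * (d : ℝ) *
                (AnisoDyadic.harmMean σ / (d : ℝ) - AnisoDyadic.expGap p q) *
                AnisoDyadic.minSmooth σ / AnisoDyadic.harmMean σ)) +
              (D : ℝ) ^ (-(AnisoDyadic.harmMean σ / (d : ℝ))))) := by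
  open AnisoDyadic in
  have hσ0 : ∀ l, 0 < σ l := fun l => (hσ l).1
  have hadapt : ∃ c C : ℝ, 0 < c ∧ 0 < C ∧ AdaptiveBound r σ p q c C := by
    rcases lt_or_ge (ENNReal.ofReal p) q with hpq | hqp
    · refine exists_adaptiveBound_of_lt r hσ0 hd hp hq hpq ?_
      rw [harmMean_div_eq hσ0 hd, lt_div_iff₀ (growthRate_pos hσ0 hd)] at hH
      linarith
    · exact ⟨1, 2, one_pos, two_pos, adaptiveBound_of_le hσ0 hqp⟩
  obtain ⟨c, C, -, hC, hadapt⟩ := hadapt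
  obtain ⟨C', hC', happrox⟩ := exists_approx_of_adaptiveBound hσ0 hd hC hadapt
  refine ⟨C', hC', fun J R p' hR hp' _ D hD1 hDJ => iSup₂_le fun s hs => ?_⟩
  obtain ⟨t, ht, hst⟩ := happrox s R hR hs.1.aestronglyMeasurable
    (level_error_le_of_mem_smoothClass hp' hs) J D hD1 hDJ
  rw [rate_exponent_eq hσ0 hd, harmMean_div_eq hσ0 hd]
  exact (iInf₂_le t ht).trans hst
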